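/- Let $n\ge 2$ be an integer, let $p=n$, and let $1<Q_1\le Q_2$ be real numbers. Put $A=\{x\in\mathbb{R}^n : 1/e<|x|<1\}$. For a nonempty open set $\Omega\subset\mathbb{R}^n$ and $Q\ge 1$, a function $u\in W^{1,p}_{\rm loc}(\Omega)$ is called a $Q$-quasiminimizer in $\Omega$ if $$\int_{\{\varphi\ne 0\}}|\nabla u|^p\,dx\le Q\int_{\{\varphi\ne 0\}}|\nabla(u+\varphi)|^p\,dx$$ for all $\varphi\in W^{1,p}_0(\Omega)$, and a $Q$-quasisuperminimizer in $\Omega$ if this holds for all nonnegative $\varphi\in W^{1,p}_0(\Omega)$. Here $W^{1,p}_0(\Omega)$ is the closure of $C_c^\infty(\Omega)$ in $W^{1,p}(\Omega)$. Then there are functions $u_1,u_2$ on $A$ such that $u_j$ is a $Q_j$-quasisuperminimizer in $A$ for $j=1,2$, but $\min\{u_1,u_2\}$ is not a $Q_2$-quasisuperminimizer in $A$, and hence not a $Q_2$-quasiminimizer in $A$. Moreover, they can be chosen as $$u_1(x)=(\log|ex|)^{\alpha_1},\qquad u_2(x)=1-(-\log|x|)^{\alpha_2},$$ with exponents $1-\frac1n<\alpha_2<1<\alpha_1$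 satisfying $Q_j=\dfrac{\alpha_j^n}{n\alpha_j-n+1}$ for $j=1,2$. -/

import Mathlib

open MeasureTheory Filter Topology
open scoped ContDiff ENNReal

namespace QuasiMin

/-- `η ∈ C_c^∞(Ω)`: smooth, with compact support contained in `Ω`. -/
def IsTestFunction {n : ℕ} (Ω : Set (EuclideanSpace ℝ (Fin n)))
    (η : EuclideanSpace ℝ (Fin n) → ℝ) : Prop :=
  ContDiff ℝ ∞ η ∧ HasCompactSupport η ∧ tsupport η ⊆ Ω

/-- `g` is the distributional (weak) gradient of `u` in `Ω`: both are locally integrable in `Ω`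
and `∫_Ω u ∇η dx = -∫_Ω η g dx` for all `η ∈ C_c^∞(Ω)`. It is unique up to null sets. -/
def HasWeakGradient {n : ℕ} (Ω : Set (EuclideanSpace ℝ (Fin n)))
    (u : EuclideanSpace ℝ (Fin n) → ℝ)
    (g : EuclideanSpace ℝ (Fin n) → EuclideanSpace ℝ (Fin n)) : Prop :=
  LocallyIntegrableOn u Ω ∧ LocallyIntegrableOn g Ω ∧
    ∀ η : EuclideanSpace ℝ (Fin n) → ℝ, IsTestFunction Ω η →
      ∫ x in Ω, u x • gradient η x = -∫ x in Ω, η x • g x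

/-- `u ∈ W^{1,p}_loc(Ω)` with weak gradient `g`. -/
def IsSobolevLoc {n : ℕ} (Ω : Set (EuclideanSpace ℝ (Fin n))) (p : ℝ)
    (u : EuclideanSpace ℝ (Fin n) → ℝ)
    (g : EuclideanSpace ℝ (Fin n) → EuclideanSpace ℝ (Fin n)) : Prop :=
  HasWeakGradient Ω u g ∧
    ∀ K : Set (EuclideanSpace ℝ (Fin n)), IsCompact K → K ⊆ Ω →
      MemLp u (ENNReal.ofReal p) (volume.restrict K) ∧
      MemLp g (ENNReal.ofReal p) (volume.restrict K)

/-- `φ ∈ W^{1,p}_0(Ω)` with weak gradient `g`: `φ` belongs to `W^{1,p}(Ω)` and is a limit, in the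
norm of `W^{1,p}(Ω)`, of functions in `C_c^∞(Ω)`. -/
def IsSobolevZero {n : ℕ} (Ω : Set (EuclideanSpace ℝ (Fin n))) (p : ℝ)
    (φ : EuclideanSpace ℝ (Fin n) → ℝ)
    (g : EuclideanSpace ℝ (Fin n) → EuclideanSpace ℝ (Fin n)) : Prop :=
  HasWeakGradient Ω φ g ∧
    MemLp φ (ENNReal.ofReal p) (volume.restrict Ω) ∧
    MemLp g (ENNReal.ofReal p) (volume.restrict Ω) ∧
    ∃ η : ℕ → EuclideanSpace ℝ (Fin n) → ℝ,
      (∀ k, IsTestFunction Ω (η k)) ∧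
      Tendsto (fun k => eLpNorm (fun x => η k x - φ x) (ENNReal.ofReal p) (volume.restrict Ω))
        atTop (𝓝 0) ∧
      Tendsto (fun k => eLpNorm (fun x => gradient (η k) x - g x) (ENNReal.ofReal p)
        (volume.restrict Ω)) atTop (𝓝 0)

/-- `u` is a `Q`-quasiminimizer in the open set `Ω` (for the `p`-energy): `u ∈ W^{1,p}_loc(Ω)` and
`∫_{φ ≠ 0} |∇u|^p dx ≤ Q ∫_{φ ≠ 0} |∇(u + φ)|^p dx` for all `φ ∈ W^{1,p}_0(Ω)`.
The integrals take values in `[0, ∞]`. -/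
def IsQuasiminimizer {n : ℕ} (Ω : Set (EuclideanSpace ℝ (Fin n))) (p Q : ℝ)
    (u : EuclideanSpace ℝ (Fin n) → ℝ) : Prop :=
  ∃ gu : EuclideanSpace ℝ (Fin n) → EuclideanSpace ℝ (Fin n), IsSobolevLoc Ω p u gu ∧
    ∀ (φ : EuclideanSpace ℝ (Fin n) → ℝ)
      (gφ : EuclideanSpace ℝ (Fin n) → EuclideanSpace ℝ (Fin n)),
      IsSobolevZero Ω p φ gφ →
      ∫⁻ x in Ω ∩ {x | φ x ≠ 0}, ‖gu x‖ₑ ^ p ≤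
        ENNReal.ofReal Q * ∫⁻ x in Ω ∩ {x | φ x ≠ 0}, ‖gu x + gφ x‖ₑ ^ p

/-- `u` is a `Q`-quasisuperminimizer in the open set `Ω` (for the `p`-energy): as for
`Q`-quasiminimizers, but with nonnegative `φ ∈ W^{1,p}_0(Ω)` only. -/
def IsQuasisuperminimizer {n : ℕ} (Ω : Set (EuclideanSpace ℝ (Fin n))) (p Q : ℝ)
    (u : EuclideanSpace ℝ (Fin n) → ℝ) : Prop :=
  ∃ gu : EuclideanSpace ℝ (Fin n) → EuclideanSpace ℝ (Fin n), IsSobolevLoc Ω p u gu ∧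
    ∀ (φ : EuclideanSpace ℝ (Fin n) → ℝ)
      (gφ : EuclideanSpace ℝ (Fin n) → EuclideanSpace ℝ (Fin n)),
      IsSobolevZero Ω p φ gφ → (∀ᵐ x ∂(volume.restrict Ω), 0 ≤ φ x) →
      ∫⁻ x in Ω ∩ {x | φ x ≠ 0}, ‖gu x‖ₑ ^ p ≤
        ENNReal.ofReal Q * ∫⁻ x in Ω ∩ {x | φ x ≠ 0}, ‖gu x + gφ x‖ₑ ^ p

/-- The annulus `{x ∈ ℝⁿ : 1/e < |x| < 1}`. -/
def annulus (n : ℕ) : Set (EuclideanSpace ℝ (Fin n)) :=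
  {x | 1 / Real.exp 1 < ‖x‖ ∧ ‖x‖ < 1}

end QuasiMin

namespace QuasiMin

/-! Put `t = 1 + log |x|`. Since `p = n`, the energy is conformally invariant: in logarithmic polar
coordinates (`lintegral_annulus`) the energy of a radial function `U (1 + log |x|)` is the measure
of the sphere times `∫₀¹ |U'|ⁿ dt`. The two functions become the profiles `t ^ α₁` and `1 - (1 - t)
^ α₂` on `(0, 1)`, each joining `(0, 0)` to `(1, 1)`.

Positive part. A profile is good if, on each subinterval, its energy is at most `Q` times that of
the chord. For powers this is a Hölder-type inequality (`profile_rpow`), and reflection preserves it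
(`Profile.reflect`). A function in `W^{1,n}_0` is absolutely continuous on almost every ray and
vanishes at both ends (`ae_ray_eq_integral`), so on a ray the set `φ ≠ 0` splits into intervals at
whose ends `φ` vanishes. On each of them Jensen's inequality says that no competitor beats the
chord. Summing over intervals and integrating over directions gives `Profile.isQuasisuperminimizer`.

Negative part. The profiles cross at exactly one `c` in `(0, 1)` (`exists_unique_crossing`), the
first being smaller on `(0, c)`. The minimum lies below the diagonal, so testing with the
nonnegative difference of diagonal and minimum would bound the energy of the minimum by `Q₂`
(`lintegral_deriv_min_le`). But `Q₂` is exactly the energy of the second profile. As that profile is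
convex, replacing it on `(0, c)` by a smaller function with the same end values strictly raises the
energy (`integral_deriv_pow_lt`), a contradiction. -/

/-! ### The quasiminimizing inequality in one variable -/

theorem pow_add_mul_sub_le_abs_pow {n : ℕ} (hn : 1 ≤ n) {m : ℝ} (hm : 0 ≤ m) (y : ℝ) :
    m ^ n + n * m ^ (n - 1) * (y - m) ≤ |y| ^ n := by
  obtain ⟨k, rfl⟩ : ∃ k, n = k + 1 := ⟨n - 1, by omega⟩
  have h1 : m ^ (k + 1) + (k + 1 : ℕ) * m ^ k * (y - m)
      ≤ m ^ (k + 1) + (k + 1 : ℕ) * m ^ k * (|y| - m) := by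
    gcongr
    exact le_abs_self y
  refine h1.trans ?_
  rcases hm.eq_or_lt with rfl | hm
  · rcases Nat.eq_zero_or_pos k with rfl | hk
    · simp
    · simp [hk.ne']
  -- Bernoulli's inequality at `|y| / m - 1`, then scaled by `m ^ (k + 1)`.
  · have h2 := one_add_mul_le_pow (a := |y| / m - 1) (by
      have : 0 ≤ |y| / m := by positivity
      linarith) (k + 1)
    have h3 := mul_le_mul_of_nonneg_left h2 (pow_nonneg hm.le (k + 1))
    have h4 : m ^ (k + 1) * (1 + (|y| / m - 1)) ^ (k + 1) = |y| ^ (k + 1) := by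
      rw [← mul_pow]; congr 1; field_simp; ring
    rw [h4] at h3
    refine le_trans (le_of_eq ?_) h3
    field_simp
    push_cast
    ring

theorem ofReal_integral_le_lintegral_ofReal {α : Type*} [MeasurableSpace α] {μ : Measure α}
    {f : α → ℝ} (hf : Integrable f μ) :
    ENNReal.ofReal (∫ x, f x ∂μ) ≤ ∫⁻ x, ENNReal.ofReal (f x) ∂μ := by
  rw [integral_eq_lintegral_pos_part_sub_lintegral_neg_part hf]
  refine (ENNReal.ofReal_le_ofReal (sub_le_self _ ENNReal.toReal_nonneg)).trans ?_
  exact ENNReal.ofReal_toReal_le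

/-- An increasing function on `[0, 1]` whose `n`-energy on each subinterval is at most `Q` times
that of the affine function with the same boundary values. -/
structure Profile (n : ℕ) (Q : ℝ) (U d : ℝ → ℝ) : Prop where
  cont : ContinuousOn U (Set.Icc 0 1)
  deriv : ∀ t ∈ Set.Ioo (0 : ℝ) 1, HasDerivAt U (d t) t
  nonneg : ∀ t ∈ Set.Ioo (0 : ℝ) 1, 0 ≤ d t
  contDeriv : ContinuousOn d (Set.Ioo 0 1)
  meas : Measurable d
  energy : ∀ a b : ℝ, 0 ≤ a → a < b → b ≤ 1 →
    ENNReal.ofReal ((b - a) ^ (n - 1)) * ∫⁻ t in Set.Ioo a b, ENNReal.ofReal (d t ^ n) ≤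
      ENNReal.ofReal Q * ENNReal.ofReal ((U b - U a) ^ n)

namespace Profile

variable {n : ℕ} {Q : ℝ} {U d : ℝ → ℝ}

/-- The derivative may blow up at `0` or `1`; its integrability comes from its sign and the
continuity of `U` up to the ends. -/
theorem integrableOn (h : Profile n Q U d) {a b : ℝ} (ha : 0 ≤ a) (hb : b ≤ 1) :
    IntegrableOn d (Set.Ioc a b) :=
  intervalIntegral.integrableOn_deriv_of_nonneg (h.cont.mono (Set.Icc_subset_Icc ha hb))
    (fun t ht => h.deriv t ⟨ha.trans_lt ht.1, ht.2.trans_le hb⟩)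
    (fun t ht => h.nonneg t ⟨ha.trans_lt ht.1, ht.2.trans_le hb⟩)

theorem integral_eq (h : Profile n Q U d) {a b : ℝ} (ha : 0 ≤ a) (hab : a ≤ b) (hb : b ≤ 1) :
    ∫ t in Set.Ioo a b, d t = U b - U a := by
  rw [← integral_Ioc_eq_integral_Ioo, ← intervalIntegral.integral_of_le hab]
  refine intervalIntegral.integral_eq_sub_of_hasDerivAt_of_le hab
    (h.cont.mono (Set.Icc_subset_Icc ha hb))
    (fun t ht => h.deriv t ⟨ha.trans_lt ht.1, ht.2.trans_le hb⟩) ?_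
  rw [intervalIntegrable_iff_integrableOn_Ioc_of_le hab]
  exact h.integrableOn ha hb

/-- Jensen's inequality in tangent-line form, so that the competitor may have infinite energy. As
`k` has mean zero, `d + k` has the mean slope `m` of `U`; the chord therefore has no more energy
than the competitor, and `energy` compares `U` with the chord. -/
theorem lintegral_Ioo_le (h : Profile n Q U d) (hn : 1 ≤ n) {a b : ℝ} (ha : 0 ≤ a) (hab : a < b)
    (hb : b ≤ 1) {k : ℝ → ℝ} (hk : IntegrableOn k (Set.Ioo a b))
    (hk0 : ∫ t in Set.Ioo a b, k t = 0) :
    ∫⁻ t in Set.Ioo a b, ENNReal.ofReal (d t ^ n) ≤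
      ENNReal.ofReal Q * ∫⁻ t in Set.Ioo a b, ENNReal.ofReal (|d t + k t| ^ n) := by
  have hba : 0 < b - a := sub_pos.2 hab
  have hd : IntegrableOn d (Set.Ioo a b) := (h.integrableOn ha hb).mono_set Set.Ioo_subset_Ioc_self
  have hint := h.integral_eq ha hab.le hb
  have hU : 0 ≤ U b - U a := by
    rw [← hint]
    exact setIntegral_nonneg measurableSet_Ioo fun t ht =>
      h.nonneg t ⟨ha.trans_lt ht.1, ht.2.trans_le hb⟩
  set m : ℝ := (U b - U a) / (b - a) with hm
  have hm0 : 0 ≤ m := div_nonneg hU hba.le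
  have hconst : IntegrableOn (fun _ : ℝ => (m : ℝ)) (Set.Ioo a b) := by simp
  have hconst' : IntegrableOn (fun _ : ℝ => (m ^ n : ℝ)) (Set.Ioo a b) := by simp
  have hg : IntegrableOn (fun t => m ^ n + n * m ^ (n - 1) * (d t + k t - m)) (Set.Ioo a b) :=
    hconst'.add (((hd.add hk).sub hconst).const_mul _)
  have hgi : ∫ t in Set.Ioo a b, (m ^ n + n * m ^ (n - 1) * (d t + k t - m)) = m ^ n * (b - a) := by
    have hdk : IntegrableOn (fun t => d t + k t - m) (Set.Ioo a b) := (hd.add hk).sub hconst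
    have hdk' : IntegrableOn (fun t => d t + k t) (Set.Ioo a b) := hd.add hk
    rw [integral_add hconst' (hdk.const_mul _), integral_const_mul, integral_sub hdk' hconst,
      integral_add hd hk, hint, hk0, add_zero]
    simp only [integral_const, MeasurableSet.univ, measureReal_restrict_apply, Set.univ_inter,
      Real.volume_real_Ioo_of_le hab.le, smul_eq_mul]
    have : (b - a) * m = U b - U a := by rw [hm]; field_simp
    rw [this]; ring
  -- The tangent line at slope `m` integrates to the energy of the chord.
  have key : ENNReal.ofReal (m ^ n * (b - a)) ≤
      ∫⁻ t in Set.Ioo a b, ENNReal.ofReal (|d t + k t| ^ n) := by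
    rw [← hgi]
    refine (ofReal_integral_le_lintegral_ofReal hg).trans (lintegral_mono fun t => ?_)
    exact ENNReal.ofReal_le_ofReal (pow_add_mul_sub_le_abs_pow hn hm0 _)
  have hE := h.energy a b ha hab hb
  have hfac : (U b - U a) ^ n = (b - a) ^ (n - 1) * (m ^ n * (b - a)) := by
    have : (b - a) * m = U b - U a := by rw [hm]; field_simp
    rw [← this, mul_pow, ← Nat.sub_add_cancel hn]
    simp only [Nat.add_sub_cancel]
    ring
  have hpos : 0 < (b - a) ^ (n - 1) := pow_pos hba _
  rw [hfac, ENNReal.ofReal_mul hpos.le, mul_left_comm] at hE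
  rw [ENNReal.mul_le_mul_iff_right (by simpa using hpos) ENNReal.ofReal_ne_top] at hE
  exact hE.trans (by gcongr)

end Profile

/-- The intervals are the components of the set where `f` is nonzero. Two that overlap coincide,
because an endpoint of one inside the other would be a zero there; disjoint nonempty open sets on
the line are countable in number. -/
theorem exists_countable_Ioo_cover {f : ℝ → ℝ} (hf : ContinuousOn f (Set.Icc 0 1)) (h0 : f 0 = 0)
    (h1 : f 1 = 0) :
    ∃ P : Set (ℝ × ℝ), P.Countable ∧
      (∀ q ∈ P, 0 ≤ q.1 ∧ q.1 < q.2 ∧ q.2 ≤ 1 ∧ f q.1 = 0 ∧ f q.2 = 0) ∧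
      P.PairwiseDisjoint (fun q => Set.Ioo q.1 q.2) ∧
      {t | t ∈ Set.Ioo (0 : ℝ) 1 ∧ f t ≠ 0} = ⋃ q ∈ P, Set.Ioo q.1 q.2 := by
  set P : Set (ℝ × ℝ) := {q | 0 ≤ q.1 ∧ q.1 < q.2 ∧ q.2 ≤ 1 ∧ f q.1 = 0 ∧ f q.2 = 0 ∧
    ∀ t ∈ Set.Ioo q.1 q.2, f t ≠ 0} with hP
  have hdisj : P.PairwiseDisjoint (fun q => Set.Ioo q.1 q.2) := by
    rintro ⟨a, b⟩ ⟨-, hab, -, hfa, hfb, hne⟩ ⟨a', b'⟩ ⟨-, hab', -, hfa', hfb', hne'⟩ hq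
    rw [Function.onFun, Set.disjoint_left]
    rintro t ⟨h1, h2⟩ ⟨h3, h4⟩
    apply hq
    simp only at *
    have e1 : a = a' := by
      rcases lt_trichotomy a a' with h | h | h
      · exact absurd hfa' (hne a' ⟨h, h3.trans h2⟩)
      · exact h
      · exact absurd hfa (hne' a ⟨h, h1.trans h4⟩)
    have e2 : b = b' := by
      rcases lt_trichotomy b b' with h | h | h
      · exact absurd hfb (hne' b ⟨h3.trans h2, h⟩)
      · exact h
      · exact absurd hfb' (hne b' ⟨h1.trans h4, h⟩)
    rw [e1, e2]
  refine ⟨P, hdisj.countable_of_isOpen (fun _ _ => isOpen_Ioo)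
    (fun q hq => Set.nonempty_Ioo.2 hq.2.1), fun q hq => ⟨hq.1, hq.2.1, hq.2.2.1, hq.2.2.2.1,
      hq.2.2.2.2.1⟩, hdisj, ?_⟩
  ext x
  simp only [Set.mem_ofPred_eq, Set.mem_iUnion, exists_prop]
  constructor
  · rintro ⟨hx, hfx⟩
    have hZ : ∀ a b : ℝ, 0 ≤ a → b ≤ 1 → IsCompact (Set.Icc a b ∩ f ⁻¹' {0}) := fun a b ha hb =>
      isCompact_Icc.of_isClosed_subset
        ((hf.mono (Set.Icc_subset_Icc ha hb)).preimage_isClosed_of_isClosed isClosed_Icc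
          isClosed_singleton) Set.inter_subset_left
    -- The component of `x` runs from the last zero before `x` to the first zero after it.
    obtain ⟨a, ⟨⟨ha0, hax⟩, hfa⟩, hamax⟩ := (hZ 0 x le_rfl hx.2.le).exists_isGreatest
      ⟨0, ⟨le_rfl, hx.1.le⟩, h0⟩
    obtain ⟨b, ⟨⟨hxb, hb1⟩, hfb⟩, hbmin⟩ := (hZ x 1 hx.1.le le_rfl).exists_isLeast
      ⟨1, ⟨hx.2.le, le_rfl⟩, h1⟩
    have hax' : a < x := lt_of_le_of_ne hax (by rintro rfl; exact hfx hfa)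
    have hxb' : x < b := lt_of_le_of_ne hxb (by rintro rfl; exact hfx hfb)
    refine ⟨(a, b), ⟨ha0, hax'.trans hxb', hb1, hfa, hfb, fun t ht htf => ?_⟩, hax', hxb'⟩
    rcases le_total t x with htx | htx
    · exact absurd (hamax ⟨⟨ha0.trans ht.1.le, htx⟩, htf⟩) (not_le.2 ht.1)
    · exact absurd (hbmin ⟨⟨htx, ht.2.le.trans hb1⟩, htf⟩) (not_le.2 ht.2)
  · rintro ⟨q, hq, hx⟩
    exact ⟨⟨hq.1.trans_lt hx.1, hx.2.trans_le hq.2.2.1⟩, hq.2.2.2.2.2 x hx⟩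

/-- On each component the primitive of `k` vanishes at both ends, so `k` has mean zero there and
`Profile.lintegral_Ioo_le` applies; both sides are then summed. -/
theorem Profile.lintegral_ne_zero_le {n : ℕ} {Q : ℝ} {U d : ℝ → ℝ} (h : Profile n Q U d)
    (hn : 1 ≤ n) {k : ℝ → ℝ} (hk : IntegrableOn k (Set.Ioc 0 1))
    (hk1 : ∫ t in (0 : ℝ)..1, k t = 0) :
    ∫⁻ t in {t | t ∈ Set.Ioo (0 : ℝ) 1 ∧ ∫ s in (0 : ℝ)..t, k s ≠ 0}, ENNReal.ofReal (d t ^ n) ≤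
      ENNReal.ofReal Q * ∫⁻ t in {t | t ∈ Set.Ioo (0 : ℝ) 1 ∧ ∫ s in (0 : ℝ)..t, k s ≠ 0},
        ENNReal.ofReal (|d t + k t| ^ n) := by
  have hkI : ∀ {a b : ℝ}, 0 ≤ a → a ≤ 1 → 0 ≤ b → b ≤ 1 → IntervalIntegrable k volume a b := by
    intro a b ha ha1 hb hb1
    rw [intervalIntegrable_iff]
    refine hk.mono_set ?_
    rw [Set.uIoc]
    exact Set.Ioc_subset_Ioc (le_min ha hb) (max_le ha1 hb1)
  have hcont : ContinuousOn (fun t => ∫ s in (0 : ℝ)..t, k s) (Set.Icc 0 1) := by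
    have := intervalIntegral.continuousOn_primitive_interval' (f := k) (μ := volume) (a := 0)
      (b₁ := 0) (b₂ := 1) (hkI le_rfl zero_le_one zero_le_one le_rfl) (by simp)
    simpa using this
  obtain ⟨P, hPc, hP, hPd, hPe⟩ := exists_countable_Ioo_cover hcont (by simp) hk1
  rw [hPe, lintegral_biUnion hPc (fun _ _ => measurableSet_Ioo) hPd,
    lintegral_biUnion hPc (fun _ _ => measurableSet_Ioo) hPd, ← ENNReal.tsum_mul_left]
  refine ENNReal.tsum_le_tsum fun ⟨q, hq⟩ => ?_
  obtain ⟨h0, h1, h2, h3, h4⟩ := hP q hq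
  refine h.lintegral_Ioo_le hn h0 h1 h2 (hk.mono_set fun t ht =>
    ⟨h0.trans_lt ht.1, ht.2.le.trans h2⟩) ?_
  rw [← integral_Ioc_eq_integral_Ioo, ← intervalIntegral.integral_of_le h1.le,
    ← intervalIntegral.integral_interval_sub_left (hkI le_rfl zero_le_one (h0.trans h1.le) h2)
      (hkI le_rfl zero_le_one h0 (h1.le.trans h2)), h3, h4, sub_zero]

/-! ### Logarithmic polar coordinates -/

/-- The surface measure on the unit sphere of `ℝⁿ`. -/
noncomputable abbrev sphereMeasure (n : ℕ) :
    Measure (Metric.sphere (0 : EuclideanSpace ℝ (Fin n)) 1) :=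
  (volume : Measure (EuclideanSpace ℝ (Fin n))).toSphere

theorem measurableSet_annulus (n : ℕ) : MeasurableSet (annulus n) :=
  (measurableSet_lt measurable_const measurable_norm).inter
    (measurableSet_lt measurable_norm measurable_const)

theorem isOpen_annulus (n : ℕ) : IsOpen (annulus n) :=
  (isOpen_lt continuous_const continuous_norm).inter (isOpen_lt continuous_norm continuous_const)

theorem volume_annulus_ne_top (n : ℕ) : volume (annulus n) ≠ ⊤ := by
  refine ((measure_mono (t := Metric.ball 0 1) fun x hx => ?_).trans_lt measure_ball_lt_top).ne
  simpa using hx.2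

theorem exp_smul_sphere_norm {n : ℕ} (t : ℝ)
    (θ : Metric.sphere (0 : EuclideanSpace ℝ (Fin n)) 1) :
    ‖Real.exp (t - 1) • (θ : EuclideanSpace ℝ (Fin n))‖ = Real.exp (t - 1) := by
  rw [norm_smul, Real.norm_of_nonneg (Real.exp_pos _).le, norm_eq_of_mem_sphere, mul_one]

theorem exp_smul_mem_annulus_iff {n : ℕ} (t : ℝ)
    (θ : Metric.sphere (0 : EuclideanSpace ℝ (Fin n)) 1) :
    Real.exp (t - 1) • (θ : EuclideanSpace ℝ (Fin n)) ∈ annulus n ↔ t ∈ Set.Ioo (0 : ℝ) 1 := by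
  have h1 : 1 / Real.exp 1 = Real.exp (-1) := by rw [Real.exp_neg, one_div]
  have h2 : Real.exp (t - 1) < 1 ↔ t - 1 < 0 := by rw [← Real.exp_zero, Real.exp_lt_exp]
  simp only [annulus, Set.mem_ofPred_eq, exp_smul_sphere_norm, h1, Real.exp_lt_exp, h2, Set.mem_Ioo]
  constructor <;> rintro ⟨h, h'⟩ <;> constructor <;> linarith

theorem image_exp_sub_one_Ioo :
    (fun t : ℝ => Real.exp (t - 1)) '' Set.Ioo 0 1 = Set.Ioo (1 / Real.exp 1) 1 := by
  have h1 : 1 / Real.exp 1 = Real.exp (-1) := by rw [Real.exp_neg, one_div]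
  ext r
  constructor
  · rintro ⟨t, ⟨h0, h1'⟩, rfl⟩
    refine ⟨by rw [h1]; exact Real.exp_lt_exp.2 (by linarith), ?_⟩
    exact (Real.exp_lt_exp.2 (by linarith)).trans_eq Real.exp_zero
  · rintro ⟨h0, h1'⟩
    have hr : 0 < r := lt_trans (by positivity) h0
    rw [h1] at h0
    refine ⟨1 + Real.log r, ⟨?_, ?_⟩, ?_⟩
    · have := (Real.lt_log_iff_exp_lt hr).2 h0
      linarith
    · have := Real.log_neg hr h1'
      linarith
    · simp [Real.exp_log hr]

/-- Integration over the annulus in logarithmic polar coordinates. -/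
theorem lintegral_annulus {n : ℕ} (hn : 1 ≤ n) {F : EuclideanSpace ℝ (Fin n) → ℝ≥0∞}
    (hF : Measurable F) :
    ∫⁻ x in annulus n, F x =
      ∫⁻ θ, (∫⁻ t in Set.Ioo (0 : ℝ) 1, ENNReal.ofReal (Real.exp (t - 1) ^ n) *
        F (Real.exp (t - 1) • (θ : EuclideanSpace ℝ (Fin n)))) ∂sphereMeasure n := by
  have : Nonempty (Fin n) := ⟨⟨0, hn⟩⟩
  set G := (annulus n).indicator F with hG
  have hGm : Measurable G := hF.indicator (measurableSet_annulus n)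
  set μ : Measure (EuclideanSpace ℝ (Fin n)) := volume with hμ
  rw [← lintegral_indicator (measurableSet_annulus n)]
  have e1 : ∫⁻ x, G x ∂μ = ∫⁻ x : ({(0)}ᶜ : Set (EuclideanSpace ℝ (Fin n))), G x ∂(μ.comap (↑)) := by
    rw [lintegral_subtype_comap (measurableSet_singleton _).compl, restrict_compl_singleton]
  set H : Metric.sphere (0 : EuclideanSpace ℝ (Fin n)) 1 × Set.Ioi (0 : ℝ) → ℝ≥0∞ :=
    fun q => G ((q.2 : ℝ) • (q.1 : EuclideanSpace ℝ (Fin n))) with hH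
  have hHm : Measurable H := by
    apply hGm.comp
    fun_prop
  have e2 := μ.measurePreserving_homeomorphUnitSphereProd.lintegral_comp hHm
  have e3 : ∀ x : ({(0)}ᶜ : Set (EuclideanSpace ℝ (Fin n))),
      H (homeomorphUnitSphereProd (EuclideanSpace ℝ (Fin n)) x) = G x := by
    intro x
    have hx : ‖(x : EuclideanSpace ℝ (Fin n))‖ ≠ 0 := norm_ne_zero_iff.2 x.2
    simp [hH, homeomorphUnitSphereProd_apply_fst_coe, homeomorphUnitSphereProd_apply_snd_coe,
      smul_smul, hx]
  simp only [e3] at e2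
  rw [e1, e2, lintegral_prod _ hHm.aemeasurable]
  refine lintegral_congr fun θ => ?_
  rw [Measure.volumeIoiPow, lintegral_withDensity_eq_lintegral_mul _ (by fun_prop)
    (by exact hHm.comp (measurable_const.prodMk measurable_id))]
  simp only [Pi.mul_apply, hH]
  rw [lintegral_subtype_comap measurableSet_Ioi (fun r : ℝ => ENNReal.ofReal
    (r ^ (Module.finrank ℝ (EuclideanSpace ℝ (Fin n)) - 1)) *
      G (r • (θ : EuclideanSpace ℝ (Fin n))))]
  have e4 : ∫⁻ r in Set.Ioi (0 : ℝ), ENNReal.ofReal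
      (r ^ (Module.finrank ℝ (EuclideanSpace ℝ (Fin n)) - 1)) *
        G (r • (θ : EuclideanSpace ℝ (Fin n))) =
      ∫⁻ r in Set.Ioo (1 / Real.exp 1) 1, ENNReal.ofReal (r ^ (n - 1)) *
        F (r • (θ : EuclideanSpace ℝ (Fin n))) := by
    rw [← lintegral_indicator measurableSet_Ioi, ← lintegral_indicator measurableSet_Ioo]
    refine lintegral_congr fun r => ?_
    by_cases hr : 0 < r
    · have hn' : ‖r • (θ : EuclideanSpace ℝ (Fin n))‖ = r := by
        rw [norm_smul, Real.norm_of_nonneg hr.le, norm_eq_of_mem_sphere, mul_one]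
      by_cases hr' : r ∈ Set.Ioo (1 / Real.exp 1) 1
      · have : r • (θ : EuclideanSpace ℝ (Fin n)) ∈ annulus n := by
          simpa only [annulus, Set.mem_ofPred_eq, hn', Set.mem_Ioo] using hr'
        rw [Set.indicator_of_mem (Set.mem_Ioi.2 hr), Set.indicator_of_mem hr', hG,
          Set.indicator_of_mem this, finrank_euclideanSpace_fin]
      · have : r • (θ : EuclideanSpace ℝ (Fin n)) ∉ annulus n := by
          simpa only [annulus, Set.mem_ofPred_eq, hn', Set.mem_Ioo] using hr'
        rw [Set.indicator_of_mem (Set.mem_Ioi.2 hr), Set.indicator_of_notMem hr', hG,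
          Set.indicator_of_notMem this, mul_zero]
    · have : r ∉ Set.Ioo (1 / Real.exp 1) 1 := fun h => hr (lt_trans (by positivity) h.1)
      rw [Set.indicator_of_notMem (by simpa using hr), Set.indicator_of_notMem this]
  -- Substituting `r = exp (t - 1)` turns `r ^ (n - 1) dr` into `exp (t - 1) ^ n dt`.
  rw [e4, ← image_exp_sub_one_Ioo, lintegral_image_eq_lintegral_abs_deriv_mul measurableSet_Ioo
    (f' := fun t => Real.exp (t - 1)) (fun x _ => ?_) (fun x _ y _ hxy => ?_)]
  · refine lintegral_congr fun t => ?_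
    rw [← mul_assoc, ← ENNReal.ofReal_mul (abs_nonneg _), abs_of_pos (Real.exp_pos _), ← pow_succ',
      Nat.sub_add_cancel hn]
  · have := ((hasDerivAt_id x).sub_const 1).exp
    simpa using this.hasDerivWithinAt
  · simpa using hxy

/-! ### Sobolev functions along rays -/

theorem measurable_ray {n : ℕ} {X : Type*} [MeasurableSpace X]
    {F : EuclideanSpace ℝ (Fin n) → X} (hF : Measurable F)
    (θ : EuclideanSpace ℝ (Fin n)) : Measurable fun t : ℝ => F (Real.exp (t - 1) • θ) := by
  apply hF.comp
  fun_prop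

/-- Indices with integrals at most `2⁻ⁱ` make the sum of the chosen functions integrable, hence
finite almost everywhere, so its terms tend to zero. -/
theorem tendsto_ae_subseq_of_lintegral {α : Type*} [MeasurableSpace α] {μ : Measure α}
    {J : ℕ → α → ℝ≥0∞} (hJ : ∀ k, Measurable (J k))
    (h : Tendsto (fun k => ∫⁻ a, J k a ∂μ) atTop (𝓝 0)) :
    ∃ ns : ℕ → ℕ, ∀ᵐ a ∂μ, Tendsto (fun i => J (ns i) a) atTop (𝓝 0) := by
  have : ∀ i : ℕ, ∃ k, ∫⁻ a, J k a ∂μ ≤ (2⁻¹ : ℝ≥0∞) ^ i := fun i =>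
    ((ENNReal.tendsto_nhds_zero.1 h) _ (ENNReal.pow_pos (by simp) i)).exists
  choose ns hns using this
  refine ⟨ns, ?_⟩
  have hsum : ∫⁻ a, ∑' i, J (ns i) a ∂μ ≠ ⊤ := by
    rw [lintegral_tsum fun i => (hJ _).aemeasurable]
    refine ne_top_of_le_ne_top ?_ (ENNReal.tsum_le_tsum hns)
    rw [ENNReal.tsum_geometric]
    simp
  filter_upwards [ae_lt_top (Measurable.tsum fun i => hJ (ns i)) hsum] with a ha
  exact ENNReal.tendsto_atTop_zero_of_tsum_ne_top (by simpa using ha.ne)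

theorem tendsto_lintegral_enorm_of_eLpNorm {α F : Type*} [MeasurableSpace α] {μ : Measure α}
    [IsFiniteMeasure μ] [NormedAddCommGroup F] {f : ℕ → α → F} {p : ℝ≥0∞} (hp : 1 ≤ p)
    (hf : ∀ k, AEStronglyMeasurable (f k) μ)
    (h : Tendsto (fun k => eLpNorm (f k) p μ) atTop (𝓝 0)) :
    Tendsto (fun k => ∫⁻ x, ‖f k x‖ₑ ∂μ) atTop (𝓝 0) := by
  have hC : μ Set.univ ^ (1 / (1 : ℝ≥0∞).toReal - 1 / p.toReal) ≠ ⊤ := by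
    refine ENNReal.rpow_ne_top_of_nonneg ?_ (measure_ne_top _ _)
    rcases eq_or_ne p ⊤ with rfl | hpt
    · simp
    · have : 1 ≤ p.toReal := by
        simpa using (ENNReal.toReal_le_toReal ENNReal.one_ne_top hpt).2 hp
      simp only [ENNReal.toReal_one, div_one, sub_nonneg, one_div]
      exact inv_le_one_of_one_le₀ this
  have h2 := ENNReal.Tendsto.mul_const (b := μ Set.univ ^ (1 / (1 : ℝ≥0∞).toReal - 1 / p.toReal)) h
    (Or.inr hC)
  rw [zero_mul] at h2
  refine tendsto_of_tendsto_of_tendsto_of_le_of_le tendsto_const_nhds h2 (fun _ => zero_le)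
    fun k => ?_
  rw [← eLpNorm_one_eq_lintegral_enorm]
  exact eLpNorm_le_eLpNorm_mul_rpow_measure_univ hp (hf k)

theorem IsTestFunction.continuous_gradient {n : ℕ} {Ω : Set (EuclideanSpace ℝ (Fin n))}
    {η : EuclideanSpace ℝ (Fin n) → ℝ} (h : IsTestFunction Ω η) : Continuous (gradient η) :=
  (InnerProductSpace.toDual ℝ _).symm.continuous.comp (h.1.continuous_fderiv (by simp))

theorem IsTestFunction.eq_zero {n : ℕ} {Ω : Set (EuclideanSpace ℝ (Fin n))}
    {η : EuclideanSpace ℝ (Fin n) → ℝ} (h : IsTestFunction Ω η) {x : EuclideanSpace ℝ (Fin n)}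
    (hx : x ∉ Ω) : η x = 0 :=
  image_eq_zero_of_notMem_tsupport fun h' => hx (h.2.2 h')

theorem hasDerivAt_ray {n : ℕ} {η : EuclideanSpace ℝ (Fin n) → ℝ} (h : Differentiable ℝ η)
    (v : EuclideanSpace ℝ (Fin n)) (t : ℝ) :
    HasDerivAt (fun t : ℝ => η (Real.exp (t - 1) • v))
      (Real.exp (t - 1) * inner ℝ (gradient η (Real.exp (t - 1) • v)) v) t := by
  have h1 : HasDerivAt (fun t : ℝ => Real.exp (t - 1) • v) (Real.exp (t - 1) • v) t := by
    have := ((hasDerivAt_id t).sub_const 1).exp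
    simp only [id_eq, mul_one] at this
    exact this.smul_const v
  have h2 := (h (Real.exp (t - 1) • v)).hasFDerivAt.comp_hasDerivAt t h1
  rw [map_smul, smul_eq_mul] at h2
  rwa [inner_gradient_left]

/-- Almost every ray restriction of a `W^{1,p}_0` function on the annulus is absolutely continuous
and vanishes at both ends. -/
theorem ae_ray_eq_integral {n : ℕ} (hn : 1 ≤ n) {p : ℝ≥0∞} (hp : 1 ≤ p)
    {φ : EuclideanSpace ℝ (Fin n) → ℝ} {g : EuclideanSpace ℝ (Fin n) → EuclideanSpace ℝ (Fin n)}
    (hφ : Measurable φ) (hg : Measurable g) {η : ℕ → EuclideanSpace ℝ (Fin n) → ℝ}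
    (hη : ∀ k, IsTestFunction (annulus n) (η k))
    (h0 : Tendsto (fun k => eLpNorm (fun x => η k x - φ x) p (volume.restrict (annulus n)))
      atTop (𝓝 0))
    (h1 : Tendsto (fun k => eLpNorm (fun x => gradient (η k) x - g x) p
      (volume.restrict (annulus n))) atTop (𝓝 0)) :
    ∀ᵐ θ : Metric.sphere (0 : EuclideanSpace ℝ (Fin n)) 1 ∂sphereMeasure n,
      IntegrableOn (fun t => Real.exp (t - 1) *
        inner ℝ (g (Real.exp (t - 1) • (θ : EuclideanSpace ℝ (Fin n)))) θ) (Set.Ioc 0 1) ∧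
      ∫ t in (0 : ℝ)..1, Real.exp (t - 1) *
        inner ℝ (g (Real.exp (t - 1) • (θ : EuclideanSpace ℝ (Fin n)))) θ = 0 ∧
      ∀ᵐ t ∂(volume.restrict (Set.Ioo (0 : ℝ) 1)),
        φ (Real.exp (t - 1) • (θ : EuclideanSpace ℝ (Fin n))) = ∫ s in (0 : ℝ)..t,
          Real.exp (s - 1) * inner ℝ (g (Real.exp (s - 1) • (θ : EuclideanSpace ℝ (Fin n)))) θ := by
  have hfin : IsFiniteMeasure (volume.restrict (annulus n)) :=
    ⟨by simpa using (volume_annulus_ne_top n).lt_top⟩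
  have hηm : ∀ k, Measurable (η k) := fun k => (hη k).1.continuous.measurable
  have hGm : ∀ k, Measurable (gradient (η k)) := fun k => (hη k).continuous_gradient.measurable
  set F : ℕ → EuclideanSpace ℝ (Fin n) → ℝ≥0∞ :=
    fun k x => ‖η k x - φ x‖ₑ + ‖gradient (η k) x - g x‖ₑ with hF
  have hFm : ∀ k, Measurable (F k) := fun k =>
    ((hηm k).sub hφ).enorm.add ((hGm k).sub hg).enorm
  have hF0 : Tendsto (fun k => ∫⁻ x in annulus n, F k x) atTop (𝓝 0) := by
    have := (tendsto_lintegral_enorm_of_eLpNorm hp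
      (fun k => ((hηm k).sub hφ).aestronglyMeasurable) h0).add
      (tendsto_lintegral_enorm_of_eLpNorm hp
      (fun k => ((hGm k).sub hg).aestronglyMeasurable) h1)
    rw [add_zero] at this
    refine this.congr fun k => ?_
    exact (lintegral_add_left ((hηm k).sub hφ).enorm _).symm
  simp only [lintegral_annulus hn (hFm _)] at hF0
  obtain ⟨ns, hns⟩ := tendsto_ae_subseq_of_lintegral (fun k => Measurable.lintegral_prod_right'
    (f := fun q : Metric.sphere (0 : EuclideanSpace ℝ (Fin n)) 1 × ℝ =>
      ENNReal.ofReal (Real.exp (q.2 - 1) ^ n) *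
        F k (Real.exp (q.2 - 1) • (q.1 : EuclideanSpace ℝ (Fin n))))
    (Measurable.mul (by fun_prop) ((hFm k).comp (by fun_prop)))) hF0
  filter_upwards [hns] with θ hθ
  set v := (θ : EuclideanSpace ℝ (Fin n)) with hv
  have hvn : ‖v‖ = 1 := norm_eq_of_mem_sphere θ
  set κ : ℝ → ℝ := fun t => Real.exp (t - 1) * inner ℝ (g (Real.exp (t - 1) • v)) v with hκ
  have hκm : Measurable κ :=
    Measurable.mul (by fun_prop) ((measurable_ray hg v).inner measurable_const)
  set D : ℕ → ℝ → ℝ := fun k t =>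
    Real.exp (t - 1) * inner ℝ (gradient (η (ns k)) (Real.exp (t - 1) • v)) v with hD
  have hDc : ∀ k, Continuous (D k) := fun k => by
    have := (hη (ns k)).continuous_gradient
    simp only [hD]
    fun_prop
  have hDint : ∀ k a b, ∫ t in a..b, D k t =
      η (ns k) (Real.exp (b - 1) • v) - η (ns k) (Real.exp (a - 1) • v) := fun k a b =>
    intervalIntegral.integral_eq_sub_of_hasDerivAt
      (fun t _ => hasDerivAt_ray ((hη (ns k)).1.differentiable (by simp)) v t)
      ((hDc k).intervalIntegrable _ _)
  -- The parameters `0` and `1` land on the boundary spheres, outside the open annulus.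
  have hend0 : ∀ k, η k (Real.exp ((0 : ℝ) - 1) • v) = 0 := fun k =>
    (hη k).eq_zero (by rw [hv, exp_smul_mem_annulus_iff]; simp)
  have hend1 : ∀ k, η k (Real.exp ((1 : ℝ) - 1) • v) = 0 := fun k =>
    (hη k).eq_zero (by rw [hv, exp_smul_mem_annulus_iff]; simp)
  set J : ℕ → ℝ≥0∞ := fun k => ∫⁻ t in Set.Ioo (0 : ℝ) 1, F (ns k) (Real.exp (t - 1) • v) with hJ
  -- The polar weight is at least `exp (-1) ^ n` on the ray, so it can be dropped.
  have hJ0 : Tendsto J atTop (𝓝 0) := by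
    set c : ℝ≥0∞ := ENNReal.ofReal (Real.exp (-1) ^ n) with hc
    have hc0 : c ≠ 0 := by simpa [hc] using pow_pos (Real.exp_pos _) n
    have hct : c ≠ ⊤ := ENNReal.ofReal_ne_top
    have h2 := ENNReal.Tendsto.const_mul (a := c⁻¹) hθ (Or.inr (ENNReal.inv_ne_top.2 hc0))
    rw [mul_zero] at h2
    refine tendsto_of_tendsto_of_tendsto_of_le_of_le tendsto_const_nhds h2 (fun _ => zero_le)
      fun k => ?_
    have e1 : J k = c⁻¹ * (c * J k) := by
      rw [← mul_assoc, ENNReal.inv_mul_cancel hc0 hct, one_mul]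
    rw [e1]
    refine mul_le_mul_right ?_ _
    rw [hJ, ← lintegral_const_mul _ (measurable_ray (hFm _) v)]
    refine setLIntegral_mono' measurableSet_Ioo fun t ht => ?_
    refine mul_le_mul_left (ENNReal.ofReal_le_ofReal ?_) _
    gcongr
    linarith [ht.1]
  have hF1 : ∀ k, ∀ t ∈ Set.Ioo (0 : ℝ) 1,
      ‖D k t - κ t‖ₑ ≤ F (ns k) (Real.exp (t - 1) • v) := by
    intro k t ht
    refine le_trans ?_ (le_add_left le_rfl)
    rw [enorm_le_iff_norm_le, hD, hκ]
    simp only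
    rw [← mul_sub, ← inner_sub_left, norm_mul, Real.norm_of_nonneg (Real.exp_pos _).le]
    have e1 : Real.exp (t - 1) ≤ 1 := Real.exp_le_one_iff.2 (by linarith [ht.2])
    have e2 := norm_inner_le_norm (𝕜 := ℝ) (gradient (η (ns k)) (Real.exp (t - 1) • v) -
      g (Real.exp (t - 1) • v)) v
    rw [hvn, mul_one] at e2
    calc _ ≤ 1 * _ := mul_le_mul e1 e2 (norm_nonneg _) zero_le_one
      _ = _ := one_mul _
  have hI : ∀ k, ∫⁻ t in Set.Ioo (0 : ℝ) 1, ‖D k t - κ t‖ₑ ≤ J k := fun k =>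
    setLIntegral_mono' measurableSet_Ioo (hF1 k)
  have hκint : IntegrableOn κ (Set.Ioo 0 1) := by
    obtain ⟨k, hk⟩ := (hJ0.eventually (gt_mem_nhds (ENNReal.zero_lt_top))).exists
    have hd : IntegrableOn (fun t => D k t - κ t) (Set.Ioo 0 1) :=
      ⟨((hDc k).measurable.sub hκm).aestronglyMeasurable, (hI k).trans_lt hk⟩
    have hDi : IntegrableOn (D k) (Set.Ioo 0 1) :=
      ((hDc k).integrableOn_Icc (a := 0) (b := 1)).mono_set Set.Ioo_subset_Icc_self
    refine (hDi.sub hd).congr (Eventually.of_forall fun t => ?_)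
    simp
  have hκint' : IntegrableOn κ (Set.Ioc 0 1) := (integrableOn_Ioc_iff_integrableOn_Ioo (by finiteness)).2 hκint
  have hκI : ∀ t ∈ Set.Icc (0 : ℝ) 1, IntervalIntegrable κ volume 0 t := fun t ht => by
    rw [intervalIntegrable_iff_integrableOn_Ioc_of_le ht.1]
    exact hκint'.mono_set (Set.Ioc_subset_Ioc_right ht.2)
  -- Uniform closeness in `t`: at `t = 1` it forces the full integral of `κ` to vanish, and for
  -- general `t` it identifies `φ` on the ray with the primitive of `κ`.
  have hdist : ∀ k, ∀ t ∈ Set.Icc (0 : ℝ) 1,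
      ‖(∫ s in (0 : ℝ)..t, κ s) - η (ns k) (Real.exp (t - 1) • v)‖ₑ ≤ J k := by
    intro k t ht
    have e1 : η (ns k) (Real.exp (t - 1) • v) = ∫ s in (0 : ℝ)..t, D k s := by
      rw [hDint, hend0, sub_zero]
    rw [e1, ← edist_eq_enorm_sub, edist_comm, edist_eq_enorm_sub,
      ← intervalIntegral.integral_sub ((hDc k).intervalIntegrable _ _) (hκI t ht),
      intervalIntegral.integral_of_le ht.1, integral_Ioc_eq_integral_Ioo]
    refine (enorm_integral_le_lintegral_enorm _).trans (le_trans ?_ (hI k))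
    exact lintegral_mono_set (Set.Ioo_subset_Ioo_right ht.2)
  refine ⟨hκint', ?_, ?_⟩
  · have h2 : ‖∫ s in (0 : ℝ)..1, κ s‖ₑ ≤ 0 := by
      refine ge_of_tendsto' hJ0 fun k => ?_
      have := hdist k 1 (by simp)
      rwa [hend1, sub_zero] at this
    simpa using h2
  · have hcont : ContinuousOn (fun t => ∫ s in (0 : ℝ)..t, κ s) (Set.Icc 0 1) := by
      have := intervalIntegral.continuousOn_primitive_interval' (f := κ) (μ := volume) (a := 0)
        (b₁ := 0) (b₂ := 1) (hκI 1 (by simp)) (by simp)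
      simpa using this
    have hm : AEMeasurable (fun t => ‖φ (Real.exp (t - 1) • v) - ∫ s in (0 : ℝ)..t, κ s‖ₑ)
        (volume.restrict (Set.Ioo 0 1)) :=
      ((measurable_ray hφ v).aemeasurable.sub
        ((hcont.mono Set.Ioo_subset_Icc_self).aemeasurable measurableSet_Ioo)).enorm
    have h2 : ∫⁻ t in Set.Ioo (0 : ℝ) 1,
        ‖φ (Real.exp (t - 1) • v) - ∫ s in (0 : ℝ)..t, κ s‖ₑ ≤ 0 := by
      have h3 := hJ0.add hJ0
      rw [add_zero] at h3
      refine ge_of_tendsto' h3 fun k => ?_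
      calc _ ≤ ∫⁻ t in Set.Ioo (0 : ℝ) 1, (F (ns k) (Real.exp (t - 1) • v) + J k) := by
            refine setLIntegral_mono' measurableSet_Ioo fun t ht => ?_
            rw [← edist_eq_enorm_sub]
            refine (edist_triangle _ (η (ns k) (Real.exp (t - 1) • v)) _).trans ?_
            refine add_le_add ?_ ?_
            · rw [edist_comm, edist_eq_enorm_sub]
              exact le_add_right le_rfl
            · rw [edist_comm, edist_eq_enorm_sub]
              exact hdist k t (Set.Ioo_subset_Icc_self ht)
        _ = J k + J k := by
            rw [lintegral_add_right _ measurable_const]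
            simp [hJ]
    have h3 := (lintegral_eq_zero_iff' hm).1 (le_antisymm h2 zero_le)
    filter_upwards [h3] with t ht
    simpa [sub_eq_zero] using ht

/-! ### Radial gradients and the inequality on the annulus -/

/-- The gradient field of the radial function `x ↦ U (1 + log ‖x‖)`, where `d` is the derivative
of `U`. -/
noncomputable def radialGradient {n : ℕ} (d : ℝ → ℝ) (x : EuclideanSpace ℝ (Fin n)) :
    EuclideanSpace ℝ (Fin n) :=
  (d (1 + Real.log ‖x‖) / ‖x‖ ^ 2) • x

theorem measurable_radialGradient {n : ℕ} {d : ℝ → ℝ} (hd : Measurable d) :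
    Measurable (radialGradient d : EuclideanSpace ℝ (Fin n) → _) := by
  unfold radialGradient
  refine Measurable.smul (Measurable.div (hd.comp ?_) (by fun_prop)) measurable_id
  exact (Real.measurable_log.comp measurable_norm).const_add 1

theorem radialGradient_ray {n : ℕ} (d : ℝ → ℝ) (t : ℝ)
    (θ : Metric.sphere (0 : EuclideanSpace ℝ (Fin n)) 1) :
    radialGradient d (Real.exp (t - 1) • (θ : EuclideanSpace ℝ (Fin n))) =
      (d t / Real.exp (t - 1)) • (θ : EuclideanSpace ℝ (Fin n)) := by
  rw [radialGradient, exp_smul_sphere_norm, Real.log_exp, smul_smul]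
  congr 1
  rw [add_sub_cancel]
  have := (Real.exp_pos (t - 1)).ne'
  field_simp

theorem ofReal_pow_mul_enorm_pow {F : Type*} [NormedAddCommGroup F] {r : ℝ} (hr : 0 ≤ r) (n : ℕ)
    (y : F) : ENNReal.ofReal (r ^ n) * ‖y‖ₑ ^ (n : ℝ) = ENNReal.ofReal ((r * ‖y‖) ^ n) := by
  rw [ENNReal.rpow_natCast, ← ofReal_norm, ← ENNReal.ofReal_pow (norm_nonneg _),
    ← ENNReal.ofReal_mul (pow_nonneg hr _), mul_pow]

/-- Conformal invariance: the weight `exp (t - 1) ^ n` exactly absorbs the factor `1 / |x|` of the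
gradient, because the exponent of the energy equals the dimension. -/
theorem exp_mul_norm_radialGradient_ray {n : ℕ} (d : ℝ → ℝ) (t : ℝ)
    (θ : Metric.sphere (0 : EuclideanSpace ℝ (Fin n)) 1) :
    Real.exp (t - 1) *
      ‖radialGradient d (Real.exp (t - 1) • (θ : EuclideanSpace ℝ (Fin n)))‖ = |d t| := by
  have := (Real.exp_pos (t - 1)).ne'
  rw [radialGradient_ray, norm_smul, norm_eq_of_mem_sphere, mul_one, Real.norm_eq_abs, abs_div,
    abs_of_pos (Real.exp_pos _)]
  field_simp

theorem setLIntegral_ray {n : ℕ} (hn : 1 ≤ n) {φ : EuclideanSpace ℝ (Fin n) → ℝ}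
    (hφ : Measurable φ) {F : EuclideanSpace ℝ (Fin n) → ℝ≥0∞} (hF : Measurable F) :
    ∫⁻ x in annulus n ∩ {x | φ x ≠ 0}, F x =
      ∫⁻ θ, (∫⁻ t in Set.Ioo (0 : ℝ) 1 ∩
        {t | φ (Real.exp (t - 1) • (θ : EuclideanSpace ℝ (Fin n))) ≠ 0},
          ENNReal.ofReal (Real.exp (t - 1) ^ n) *
            F (Real.exp (t - 1) • (θ : EuclideanSpace ℝ (Fin n)))) ∂sphereMeasure n := by
  have hs : MeasurableSet {x | φ x ≠ 0} := (measurableSet_eq_fun hφ measurable_const).compl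
  rw [Set.inter_comm, ← setLIntegral_indicator hs, lintegral_annulus hn (hF.indicator hs)]
  refine lintegral_congr fun θ => ?_
  have hs' : MeasurableSet {t | φ (Real.exp (t - 1) • (θ : EuclideanSpace ℝ (Fin n))) ≠ 0} :=
    measurable_ray hφ _ (measurableSet_singleton 0).compl
  rw [Set.inter_comm, ← setLIntegral_indicator hs']
  refine lintegral_congr fun t => ?_
  by_cases h : φ (Real.exp (t - 1) • (θ : EuclideanSpace ℝ (Fin n))) = 0
  · simp [Set.indicator, h]
  · simp [Set.indicator, h]

/-- A radial function with a quasiminimizing profile satisfies the quasiminimizing inequality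
in the annulus. -/
theorem Profile.lintegral_annulus_le {n : ℕ} {Q : ℝ} {U d : ℝ → ℝ} (h : Profile n Q U d)
    (hn : 1 ≤ n) {φ : EuclideanSpace ℝ (Fin n) → ℝ}
    {g : EuclideanSpace ℝ (Fin n) → EuclideanSpace ℝ (Fin n)}
    (hφ : IsSobolevZero (annulus n) n φ g) :
    ∫⁻ x in annulus n ∩ {x | φ x ≠ 0}, ‖radialGradient d x‖ₑ ^ (n : ℝ) ≤
      ENNReal.ofReal Q *
        ∫⁻ x in annulus n ∩ {x | φ x ≠ 0}, ‖radialGradient d x + g x‖ₑ ^ (n : ℝ) := by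
  obtain ⟨-, hφL, hgL, η, hη, h0, h1⟩ := hφ
  -- Polar coordinates need measurable functions; changing `φ` and `g` on a null set affects neither
  -- integral.
  set φ' := hφL.1.mk φ with hφ'
  set g' := hgL.1.mk g with hg'
  have hφm : Measurable φ' := hφL.1.stronglyMeasurable_mk.measurable
  have hgm : Measurable g' := hgL.1.stronglyMeasurable_mk.measurable
  have eφ : φ =ᵐ[volume.restrict (annulus n)] φ' := hφL.1.ae_eq_mk
  have eg : g =ᵐ[volume.restrict (annulus n)] g' := hgL.1.ae_eq_mk
  have hset : (annulus n ∩ {x | φ x ≠ 0} : Set _) =ᵐ[volume] (annulus n ∩ {x | φ' x ≠ 0} : Set _) := by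
    have := (ae_restrict_iff' (measurableSet_annulus n)).1 eφ
    filter_upwards [this] with x hx
    apply propext
    constructor <;> rintro ⟨hxA, hx'⟩ <;> refine ⟨hxA, ?_⟩
    · simpa [← hx hxA] using hx'
    · simpa [hx hxA] using hx'
  have hsub : volume.restrict (annulus n ∩ {x | φ' x ≠ 0}) ≤ volume.restrict (annulus n) :=
    Measure.restrict_mono Set.inter_subset_left le_rfl
  rw [setLIntegral_congr hset, setLIntegral_congr hset]
  have eR : ∫⁻ x in annulus n ∩ {x | φ' x ≠ 0}, ‖radialGradient d x + g x‖ₑ ^ (n : ℝ) =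
      ∫⁻ x in annulus n ∩ {x | φ' x ≠ 0}, ‖radialGradient d x + g' x‖ₑ ^ (n : ℝ) := by
    refine lintegral_congr_ae ?_
    filter_upwards [(Measure.absolutelyContinuous_of_le hsub).ae_le eg] with x hx
    rw [hx]
  have hdm := measurable_radialGradient (n := n) h.meas
  rw [eR, setLIntegral_ray hn hφm (hdm.enorm.pow_const _),
    setLIntegral_ray hn hφm
      (F := fun x => ‖radialGradient d x + g' x‖ₑ ^ (n : ℝ)) ((hdm.add hgm).enorm.pow_const _), ← lintegral_const_mul' _ _
      ENNReal.ofReal_ne_top]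
  have hray := ae_ray_eq_integral hn (p := ENNReal.ofReal n) (by simpa using hn) hφm hgm hη
    (by refine h0.congr fun k => eLpNorm_congr_ae ?_
        filter_upwards [eφ] with x hx
        rw [hx])
    (by refine h1.congr fun k => eLpNorm_congr_ae ?_
        filter_upwards [eg] with x hx
        rw [hx])
  refine lintegral_mono_ae ?_
  filter_upwards [hray] with θ hθ
  obtain ⟨hκ, hκ0, hae⟩ := hθ
  set v := (θ : EuclideanSpace ℝ (Fin n)) with hv
  have hset2 : (Set.Ioo (0 : ℝ) 1 ∩ {t | φ' (Real.exp (t - 1) • v) ≠ 0} : Set ℝ) =ᵐ[volume]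
      {t | t ∈ Set.Ioo (0 : ℝ) 1 ∧ ∫ s in (0 : ℝ)..t,
        Real.exp (s - 1) * inner ℝ (g' (Real.exp (s - 1) • v)) v ≠ 0} := by
    have := (ae_restrict_iff' measurableSet_Ioo).1 hae
    filter_upwards [this] with t ht
    apply propext
    constructor <;> rintro ⟨htA, ht'⟩ <;> refine ⟨htA, ?_⟩
    · simpa only [Set.mem_ofPred_eq, ← ht htA] using ht'
    · simpa only [Set.mem_ofPred_eq, ht htA] using ht'
  have hr := fun t : ℝ => (Real.exp_pos (t - 1)).le
  simp only [ofReal_pow_mul_enorm_pow (hr _)]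
  have eL : ∫⁻ t in Set.Ioo (0 : ℝ) 1 ∩ {t | φ' (Real.exp (t - 1) • v) ≠ 0},
      ENNReal.ofReal ((Real.exp (t - 1) * ‖radialGradient d (Real.exp (t - 1) • v)‖) ^ n) =
      ∫⁻ t in Set.Ioo (0 : ℝ) 1 ∩ {t | φ' (Real.exp (t - 1) • v) ≠ 0},
        ENNReal.ofReal (d t ^ n) := by
    refine setLIntegral_congr_fun (measurableSet_Ioo.inter
      (measurable_ray hφm v (measurableSet_singleton 0).compl)) fun t ht => ?_
    simp only [hv]
    rw [exp_mul_norm_radialGradient_ray, abs_of_nonneg (h.nonneg t ht.1)]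
  rw [eL, setLIntegral_congr hset2, setLIntegral_congr hset2]
  have key := h.lintegral_ne_zero_le hn hκ hκ0
  refine key.trans (mul_le_mul_right (lintegral_mono fun t => ?_) _)
  · refine ENNReal.ofReal_le_ofReal (pow_le_pow_left₀ (abs_nonneg _) ?_ _)
    -- Only the radial component of `g'` enters the one-dimensional problem; dropping the rest by
    -- Cauchy–Schwarz lowers the competitor's energy.
    have e1 : d t = Real.exp (t - 1) * inner ℝ (radialGradient d (Real.exp (t - 1) • v)) v := by
      rw [hv, radialGradient_ray, inner_smul_left, real_inner_self_eq_norm_sq,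
        norm_eq_of_mem_sphere]
      have := (Real.exp_pos (t - 1)).ne'
      simp
      field_simp
    conv_lhs => rw [e1]
    rw [← mul_add, ← inner_add_left, abs_mul, abs_of_pos (Real.exp_pos _)]
    refine mul_le_mul_of_nonneg_left ?_ (hr t)
    have := abs_real_inner_le_norm (radialGradient d (Real.exp (t - 1) • v) +
      g' (Real.exp (t - 1) • v)) v
    rwa [hv, norm_eq_of_mem_sphere, mul_one] at this

/-! ### Classical and weak gradients -/

theorem hasGradientAt_radial {n : ℕ} {U : ℝ → ℝ} {d : ℝ} {x : EuclideanSpace ℝ (Fin n)}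
    (hx : x ≠ 0) (hU : HasDerivAt U d (1 + Real.log ‖x‖)) :
    HasGradientAt (fun y : EuclideanSpace ℝ (Fin n) => U (1 + Real.log ‖y‖))
      ((d / ‖x‖ ^ 2) • x) x := by
  rw [hasGradientAt_iff_hasFDerivAt]
  have hx' : ‖x‖ ^ 2 ≠ 0 := by simpa using hx
  have h1 : HasFDerivAt (fun y : EuclideanSpace ℝ (Fin n) => 1 + 2⁻¹ * Real.log (‖y‖ ^ 2))
      ((2⁻¹ : ℝ) • ((‖x‖ ^ 2)⁻¹ • (2 • (innerSL ℝ) x))) x :=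
    (((hasStrictFDerivAt_norm_sq x).hasFDerivAt.log hx').const_mul 2⁻¹).const_add 1
  have e : (fun y : EuclideanSpace ℝ (Fin n) => 1 + 2⁻¹ * Real.log (‖y‖ ^ 2)) =
      fun y => 1 + Real.log ‖y‖ := by
    funext y
    rw [Real.log_pow]
    push_cast
    ring
  rw [e] at h1
  have h2 := hU.comp_hasFDerivAt x h1
  refine h2.congr_fderiv ?_
  ext y
  simp
  field_simp

theorem integrable_mul_of_isTestFunction {n : ℕ} {Ω : Set (EuclideanSpace ℝ (Fin n))}
    {f ψ : EuclideanSpace ℝ (Fin n) → ℝ} (hf : ContinuousOn f Ω) (hψ : Continuous ψ)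
    (hc : HasCompactSupport ψ) (hs : tsupport ψ ⊆ Ω) : Integrable (fun x => f x * ψ x) := by
  rw [← integrableOn_iff_integrable_of_support_subset (s := tsupport ψ)]
  · exact ((hf.mono hs).mul hψ.continuousOn).integrableOn_compact hc
  · intro x hx
    exact subset_tsupport _ (right_ne_zero_of_mul hx)

theorem IsTestFunction.gradient_eq_zero {n : ℕ} {Ω : Set (EuclideanSpace ℝ (Fin n))}
    {η : EuclideanSpace ℝ (Fin n) → ℝ} (h : IsTestFunction Ω η) {x : EuclideanSpace ℝ (Fin n)}
    (hx : x ∉ Ω) : gradient η x = 0 := by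
  have : fderiv ℝ η x = 0 :=
    image_eq_zero_of_notMem_tsupport fun h' => hx (h.2.2 (tsupport_fderiv_subset ℝ h'))
  rw [gradient, this, map_zero]

/-- Integration by parts in each fixed direction `v`. Nothing is known about `u` off `Ω`, but every
product involved is supported in a compact subset of `Ω`. -/
theorem integral_smul_gradient_eq_neg {n : ℕ} {Ω : Set (EuclideanSpace ℝ (Fin n))}
    {u : EuclideanSpace ℝ (Fin n) → ℝ} {g : EuclideanSpace ℝ (Fin n) → EuclideanSpace ℝ (Fin n)}
    (hg : ContinuousOn g Ω) (hu : ∀ x ∈ Ω, HasGradientAt u (g x) x)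
    {η : EuclideanSpace ℝ (Fin n) → ℝ} (hη : IsTestFunction Ω η) :
    ∫ x, u x • gradient η x = -∫ x, η x • g x := by
  have huc : ContinuousOn u Ω := fun x hx => (hu x hx).differentiableAt.continuousAt.continuousWithinAt
  have hdη : Continuous (fderiv ℝ η) := hη.1.continuous_fderiv (by simp)
  have hcη : HasCompactSupport (fderiv ℝ η) := hη.2.1.fderiv ℝ
  have hsη : tsupport (fderiv ℝ η) ⊆ Ω := (tsupport_fderiv_subset ℝ).trans hη.2.2
  have hI1 : Integrable (fun x => u x • gradient η x) := by
    rw [← integrableOn_iff_integrable_of_support_subset (s := tsupport (fderiv ℝ η))]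
    · exact ((huc.mono hsη).smul hη.continuous_gradient.continuousOn).integrableOn_compact hcη
    · intro x hx
      refine subset_tsupport _ fun h0 => right_ne_zero_of_smul hx ?_
      rw [gradient, h0, map_zero]
  have hI2 : Integrable (fun x => η x • g x) := by
    rw [← integrableOn_iff_integrable_of_support_subset (s := tsupport η)]
    · exact (hη.1.continuous.continuousOn.smul (hg.mono hη.2.2)).integrableOn_compact hη.2.1
    · intro x hx
      exact subset_tsupport _ (left_ne_zero_of_smul hx)
  have hfd : ∀ v, ∀ x ∈ Ω, fderiv ℝ u x v = inner ℝ v (g x) := fun v x hx => by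
    rw [(hu x hx).fderiv_apply, real_inner_comm]
  have hprod : ∀ v, (fun x => fderiv ℝ u x v * η x) = fun x => inner ℝ v (g x) * η x := by
    intro v
    funext x
    by_cases hx : x ∈ Ω
    · rw [hfd v x hx]
    · rw [hη.eq_zero hx, mul_zero, mul_zero]
  refine ext_inner_left ℝ fun v => ?_
  rw [inner_neg_right, ← integral_inner hI1, ← integral_inner hI2]
  have key := integral_mul_fderiv_eq_neg_fderiv_mul_of_integrable (μ := volume) (f := u) (g := η)
    (v := v) ?_ ?_ ?_ (fun x hx => (hu x (hη.2.2 hx)).differentiableAt)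
    (fun x _ => hη.1.differentiable (by simp) x)
  · rw [hprod] at key
    have eA : (fun x => inner ℝ v (u x • gradient η x)) = fun x => u x * fderiv ℝ η x v := by
      funext x
      rw [inner_smul_right, ← inner_gradient_left, real_inner_comm]
    have eB : (fun x => inner ℝ v (η x • g x)) = fun x => inner ℝ v (g x) * η x := by
      funext x
      rw [inner_smul_right, mul_comm]
    rw [eA, eB, key]
  · rw [hprod]
    exact integrable_mul_of_isTestFunction (continuousOn_const.inner hg) hη.1.continuous hη.2.1
      hη.2.2
  · refine integrable_mul_of_isTestFunction huc (hdη.clm_apply continuous_const) ?_ ?_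
    · exact hcη.comp_left (g := fun L : EuclideanSpace ℝ (Fin n) →L[ℝ] ℝ => L v) (by simp)
    · refine (closure_mono fun x hx => ?_).trans hsη
      intro h0
      exact hx (by simp [h0])
  · exact integrable_mul_of_isTestFunction huc hη.1.continuous hη.2.1 hη.2.2

theorem setIntegral_smul_gradient {n : ℕ} {Ω : Set (EuclideanSpace ℝ (Fin n))}
    (u : EuclideanSpace ℝ (Fin n) → ℝ) {η : EuclideanSpace ℝ (Fin n) → ℝ}
    (hη : IsTestFunction Ω η) : ∫ x in Ω, u x • gradient η x = ∫ x, u x • gradient η x :=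
  setIntegral_eq_integral_of_forall_compl_eq_zero fun x hx => by
    rw [hη.gradient_eq_zero hx, smul_zero]

theorem setIntegral_testFunction_smul {n : ℕ} {Ω : Set (EuclideanSpace ℝ (Fin n))}
    (g : EuclideanSpace ℝ (Fin n) → EuclideanSpace ℝ (Fin n))
    {η : EuclideanSpace ℝ (Fin n) → ℝ}
    (hη : IsTestFunction Ω η) : ∫ x in Ω, η x • g x = ∫ x, η x • g x :=
  setIntegral_eq_integral_of_forall_compl_eq_zero fun x hx => by
    rw [hη.eq_zero hx, zero_smul]

theorem hasWeakGradient_of_hasGradientAt {n : ℕ} {Ω : Set (EuclideanSpace ℝ (Fin n))}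
    (hΩ : MeasurableSet Ω)
    {u : EuclideanSpace ℝ (Fin n) → ℝ} {g : EuclideanSpace ℝ (Fin n) → EuclideanSpace ℝ (Fin n)}
    (hg : ContinuousOn g Ω) (hu : ∀ x ∈ Ω, HasGradientAt u (g x) x) : HasWeakGradient Ω u g := by
  have huc : ContinuousOn u Ω := fun x hx => (hu x hx).differentiableAt.continuousAt.continuousWithinAt
  refine ⟨huc.locallyIntegrableOn hΩ, hg.locallyIntegrableOn hΩ, fun η hη => ?_⟩
  rw [setIntegral_smul_gradient u hη, setIntegral_testFunction_smul g hη]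
  exact integral_smul_gradient_eq_neg hg hu hη

theorem memLp_restrict_of_continuousOn {X F : Type*} [TopologicalSpace X] [MeasurableSpace X]
    [OpensMeasurableSpace X] [T2Space X] [NormedAddCommGroup F] [SecondCountableTopologyEither X F]
    {μ : Measure X} [IsFiniteMeasureOnCompacts μ] {K : Set X} (hK : IsCompact K) {f : X → F}
    (hf : ContinuousOn f K) (p : ℝ≥0∞) : MemLp f p (μ.restrict K) := by
  have : IsFiniteMeasure (μ.restrict K) := ⟨by simpa using hK.measure_lt_top⟩
  obtain ⟨C, hC⟩ := hK.exists_bound_of_continuousOn hf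
  exact MemLp.of_bound (hf.aestronglyMeasurable hK.measurableSet) C
    ((ae_restrict_iff' hK.measurableSet).2 (Eventually.of_forall hC))

theorem isSobolevLoc_of_hasGradientAt {n : ℕ} {Ω : Set (EuclideanSpace ℝ (Fin n))}
    (hΩ : MeasurableSet Ω) (p : ℝ)
    {u : EuclideanSpace ℝ (Fin n) → ℝ} {g : EuclideanSpace ℝ (Fin n) → EuclideanSpace ℝ (Fin n)}
    (hg : ContinuousOn g Ω) (hu : ∀ x ∈ Ω, HasGradientAt u (g x) x) : IsSobolevLoc Ω p u g := by
  have huc : ContinuousOn u Ω := fun x hx => (hu x hx).differentiableAt.continuousAt.continuousWithinAt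
  refine ⟨hasWeakGradient_of_hasGradientAt hΩ hg hu, fun K hK hKΩ => ?_⟩
  exact ⟨memLp_restrict_of_continuousOn hK (huc.mono hKΩ) _,
    memLp_restrict_of_continuousOn hK (hg.mono hKΩ) _⟩

/-- A weak gradient agrees almost everywhere with the classical one on open sets where the
function is continuously differentiable. -/
theorem HasWeakGradient.ae_eq_of_hasGradientAt {n : ℕ} {Ω O : Set (EuclideanSpace ℝ (Fin n))}
    {u : EuclideanSpace ℝ (Fin n) → ℝ} {g g₀ : EuclideanSpace ℝ (Fin n) → EuclideanSpace ℝ (Fin n)}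
    (h : HasWeakGradient Ω u g) (hO : IsOpen O) (hOΩ : O ⊆ Ω) (hg : ContinuousOn g₀ O)
    (hu : ∀ x ∈ O, HasGradientAt u (g₀ x) x) : ∀ᵐ x, x ∈ O → g x = g₀ x := by
  have hgl : LocallyIntegrableOn g O := h.2.1.mono_set hOΩ
  have hg0l : LocallyIntegrableOn g₀ O := hg.locallyIntegrableOn hO.measurableSet
  have key := hO.ae_eq_zero_of_integral_contDiff_smul_eq_zero (f := g - g₀) (hgl.sub hg0l) ?_
  · filter_upwards [key] with x hx hxO
    exact sub_eq_zero.1 (hx hxO)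
  intro η h1 h2 h3
  have hηO : IsTestFunction O η := ⟨h1, h2, h3⟩
  have hηΩ : IsTestFunction Ω η := ⟨h1, h2, h3.trans hOΩ⟩
  have e1 := h.2.2 η hηΩ
  rw [setIntegral_smul_gradient u hηΩ, setIntegral_testFunction_smul g hηΩ] at e1
  have e2 := integral_smul_gradient_eq_neg hg hu hηO
  have hint : ∀ {f : EuclideanSpace ℝ (Fin n) → EuclideanSpace ℝ (Fin n)},
      LocallyIntegrableOn f O → Integrable fun x => η x • f x := by
    intro f hf
    rw [← integrableOn_iff_integrable_of_support_subset (s := tsupport η)]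
    · exact (hf.integrableOn_compact_subset h3 h2).continuousOn_smul h1.continuous.continuousOn h2
    · intro x hx
      exact subset_tsupport _ (left_ne_zero_of_smul hx)
  simp only [Pi.sub_apply, smul_sub]
  rw [integral_sub (hint hgl) (hint hg0l), sub_eq_zero, ← neg_inj, ← e1, ← e2]

theorem IsTestFunction.isSobolevZero {n : ℕ} {Ω : Set (EuclideanSpace ℝ (Fin n))}
    (hΩ : MeasurableSet Ω) {φ : EuclideanSpace ℝ (Fin n) → ℝ} (h : IsTestFunction Ω φ) (p : ℝ) :
    IsSobolevZero Ω p φ (gradient φ) := by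
  refine ⟨hasWeakGradient_of_hasGradientAt hΩ h.continuous_gradient.continuousOn fun x _ =>
    (h.1.differentiable (by simp) x).hasGradientAt, ?_, ?_, fun _ => φ, fun _ => h, by simp,
    by simp⟩
  · exact (h.1.continuous.memLp_of_hasCompactSupport h.2.1).restrict _
  · refine (h.continuous_gradient.memLp_of_hasCompactSupport ?_).restrict _
    exact (h.2.1.fderiv ℝ).comp_left (g := (InnerProductSpace.toDual ℝ _).symm) (map_zero _)

/-! ### Radial functions on the annulus -/

/-- The support lies in the closed shell `K` over `tsupport h`, which is compact in the annulus.
Thus the function is zero near the origin, where the logarithm is singular. -/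
theorem isTestFunction_radial {n : ℕ} {h : ℝ → ℝ} (hs : ContDiff ℝ ∞ h) (hc : HasCompactSupport h)
    (hsub : tsupport h ⊆ Set.Ioo 0 1) :
    IsTestFunction (annulus n) fun x => h (1 + Real.log ‖x‖) := by
  set K : Set (EuclideanSpace ℝ (Fin n)) :=
    norm ⁻¹' ((fun r => Real.exp (r - 1)) '' tsupport h) with hK
  have hKA : K ⊆ annulus n := by
    rintro x ⟨r, hr, hrx⟩
    have := Set.mem_image_of_mem (fun r => Real.exp (r - 1)) (hsub hr)
    rw [image_exp_sub_one_Ioo] at this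
    simp only at hrx this
    rw [hrx] at this
    exact this
  have hKc : IsCompact K := by
    refine Metric.isCompact_of_isClosed_isBounded ?_ ?_
    · exact ((hc.isCompact.image (by fun_prop)).isClosed).preimage continuous_norm
    · refine (Metric.isBounded_ball (x := 0) (r := 1)).subset fun x hx => ?_
      simpa using (hKA hx).2
  have hzero : ∀ x, x ∉ K → h (1 + Real.log ‖x‖) = 0 := by
    intro x hx
    by_contra h0
    have hs := subset_tsupport h h0
    refine hx ⟨_, hs, ?_⟩
    -- At the origin the convention `log 0 = 0` gives the parameter `1`, which lies outside the open
    -- interval containing `tsupport h`.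
    have hx0 : 0 < ‖x‖ := by
      refine lt_of_le_of_ne (norm_nonneg x) fun h' => ?_
      have := (hsub hs).2
      rw [← h', Real.log_zero, add_zero] at this
      exact lt_irrefl _ this
    simp [Real.exp_log hx0]
  refine ⟨contDiff_iff_contDiffAt.2 fun x => ?_, HasCompactSupport.intro hKc hzero,
    (closure_minimal (fun x hx => ?_) hKc.isClosed).trans hKA⟩
  · by_cases hx : x = 0
    · have h0 : x ∉ K := fun h' => by
        have := (hKA h').1
        rw [hx, norm_zero] at this
        exact absurd this (not_lt.2 (by positivity))
      have : (fun x => h (1 + Real.log ‖x‖)) =ᶠ[𝓝 x] fun _ => (0 : ℝ) := by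
        filter_upwards [hKc.isClosed.isOpen_compl.mem_nhds h0] with y hy
        exact hzero y hy
      exact contDiffAt_const.congr_of_eventuallyEq this
    · have h1 : ContDiffAt ℝ ∞ (fun x : EuclideanSpace ℝ (Fin n) => 1 + Real.log ‖x‖) x :=
        contDiffAt_const.add ((contDiffAt_norm ℝ hx).log (norm_ne_zero_iff.2 hx))
      exact hs.contDiffAt.comp x h1
  · by_contra h'
    exact hx (hzero x h')

theorem one_add_log_norm_mem_Ioo {n : ℕ} {x : EuclideanSpace ℝ (Fin n)} (hx : x ∈ annulus n) :
    1 + Real.log ‖x‖ ∈ Set.Ioo (0 : ℝ) 1 := by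
  have h1 : 1 / Real.exp 1 = Real.exp (-1) := by rw [Real.exp_neg, one_div]
  have h0 : 0 < ‖x‖ := lt_trans (by positivity) hx.1
  have h2 := hx.1
  rw [h1] at h2
  have h3 := (Real.lt_log_iff_exp_lt h0).2 h2
  have h4 := Real.log_neg h0 hx.2
  constructor <;> linarith

theorem ne_zero_of_mem_annulus {n : ℕ} {x : EuclideanSpace ℝ (Fin n)} (hx : x ∈ annulus n) :
    x ≠ 0 :=
  norm_pos_iff.1 (lt_trans (by positivity) hx.1)

theorem continuousOn_radialGradient {n : ℕ} {d : ℝ → ℝ} {s : Set ℝ} (hd : ContinuousOn d s)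
    {O : Set (EuclideanSpace ℝ (Fin n))} (hO : O ⊆ annulus n)
    (hs : ∀ x ∈ O, 1 + Real.log ‖x‖ ∈ s) : ContinuousOn (radialGradient d) O := by
  have hlog : ContinuousOn (fun x : EuclideanSpace ℝ (Fin n) => 1 + Real.log ‖x‖) O :=
    continuousOn_const.add (continuous_norm.continuousOn.log fun x hx =>
      norm_ne_zero_iff.2 (ne_zero_of_mem_annulus (hO hx)))
  refine ((hd.comp hlog hs).div (by fun_prop) fun x hx => ?_).smul continuousOn_id
  exact pow_ne_zero _ (norm_ne_zero_iff.2 (ne_zero_of_mem_annulus (hO hx)))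

/-- A radial function with a quasiminimizing profile is a quasisuperminimizer. -/
theorem Profile.isQuasisuperminimizer {n : ℕ} {Q : ℝ} {U d : ℝ → ℝ} (h : Profile n Q U d)
    (hn : 1 ≤ n) :
    IsQuasisuperminimizer (annulus n) n Q fun x => U (1 + Real.log ‖x‖) := by
  refine ⟨radialGradient d, isSobolevLoc_of_hasGradientAt (measurableSet_annulus n) n
    (continuousOn_radialGradient h.contDeriv subset_rfl fun x hx => one_add_log_norm_mem_Ioo hx)
    fun x hx => hasGradientAt_radial (ne_zero_of_mem_annulus hx)
      (h.deriv _ (one_add_log_norm_mem_Ioo hx)), fun φ g hφ _ => h.lintegral_annulus_le hn hφ⟩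

/-- The quasisuperminimizing inequality of a radial function, tested with smooth radial functions
and expressed in the logarithmic radial variable. -/
theorem IsQuasisuperminimizer.lintegral_profile_le {n : ℕ} (hn : 1 ≤ n) {Q c : ℝ} {V d : ℝ → ℝ}
    (hV : IsQuasisuperminimizer (annulus n) n Q fun x => V (1 + Real.log ‖x‖))
    (hdm : Measurable d) (hdc : ContinuousOn d (Set.Ioo 0 1 \ {c}))
    (hd : ∀ t ∈ Set.Ioo (0 : ℝ) 1 \ {c}, HasDerivAt V (d t) t)
    {h : ℝ → ℝ} (hs : ContDiff ℝ ∞ h) (hc : HasCompactSupport h)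
    (hsub : tsupport h ⊆ Set.Ioo 0 1) (hnn : ∀ t, 0 ≤ h t) :
    ∫⁻ t in Set.Ioo (0 : ℝ) 1 ∩ {t | h t ≠ 0}, ENNReal.ofReal (|d t| ^ n) ≤
      ENNReal.ofReal Q *
        ∫⁻ t in Set.Ioo (0 : ℝ) 1 ∩ {t | h t ≠ 0}, ENNReal.ofReal (|d t + deriv h t| ^ n) := by
  have : Nonempty (Fin n) := ⟨⟨0, hn⟩⟩
  obtain ⟨gu, ⟨hgu, -⟩, hq⟩ := hV
  set φ : EuclideanSpace ℝ (Fin n) → ℝ := fun x => h (1 + Real.log ‖x‖) with hφ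
  have hφt : IsTestFunction (annulus n) φ := isTestFunction_radial hs hc hsub
  have hφm : Measurable φ := hφt.1.continuous.measurable
  have hdh : Measurable (deriv h) := measurable_deriv h
  have hineq := hq φ (gradient φ) (hφt.isSobolevZero (measurableSet_annulus n) n)
    (Eventually.of_forall fun x => hnn _)
  -- The sphere over the possible kink `c` is removed; being null, it does not affect the
  -- identification of `gu`.
  set O : Set (EuclideanSpace ℝ (Fin n)) := annulus n \ Metric.sphere 0 (Real.exp (c - 1)) with hO
  have hOo : IsOpen O := (isOpen_annulus n).sdiff Metric.isClosed_sphere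
  have hOs : ∀ x ∈ O, 1 + Real.log ‖x‖ ∈ Set.Ioo (0 : ℝ) 1 \ {c} := by
    rintro x ⟨hxA, hxc⟩
    refine ⟨one_add_log_norm_mem_Ioo hxA, fun h' => hxc ?_⟩
    have h0 : 0 < ‖x‖ := norm_pos_iff.2 (ne_zero_of_mem_annulus hxA)
    rw [mem_sphere_zero_iff_norm, ← Set.mem_singleton_iff.1 h', add_sub_cancel_left, Real.exp_log h0]
  have hae := hgu.ae_eq_of_hasGradientAt hOo Set.sdiff_subset
    (continuousOn_radialGradient hdc Set.sdiff_subset hOs)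
    fun x hx => hasGradientAt_radial (ne_zero_of_mem_annulus hx.1) (hd _ (hOs x hx))
  have hsphere : ∀ᵐ x : EuclideanSpace ℝ (Fin n), x ∉ Metric.sphere 0 (Real.exp (c - 1)) :=
    measure_eq_zero_iff_ae_notMem.1 (Measure.addHaar_sphere _ _ _)
  have hgu' : ∀ᵐ x, x ∈ annulus n → gu x = radialGradient d x := by
    filter_upwards [hae, hsphere] with x h1 h2 hxA
    exact h1 ⟨hxA, h2⟩
  have hgφ : ∀ x ∈ annulus n, gradient φ x = radialGradient (deriv h) x := fun x hx =>
    (hasGradientAt_radial (ne_zero_of_mem_annulus hx)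
      (hs.differentiable (by simp) _).hasDerivAt).gradient
  have hms : MeasurableSet (annulus n ∩ {x | φ x ≠ 0}) :=
    (measurableSet_annulus n).inter (hφm (measurableSet_singleton 0).compl)
  have eL : ∫⁻ x in annulus n ∩ {x | φ x ≠ 0}, ‖gu x‖ₑ ^ (n : ℝ) =
      ∫⁻ x in annulus n ∩ {x | φ x ≠ 0}, ‖radialGradient d x‖ₑ ^ (n : ℝ) := by
    refine setLIntegral_congr_fun_ae hms ?_
    filter_upwards [hgu'] with x hx hxs
    rw [hx hxs.1]
  have eR : ∫⁻ x in annulus n ∩ {x | φ x ≠ 0}, ‖gu x + gradient φ x‖ₑ ^ (n : ℝ) =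
      ∫⁻ x in annulus n ∩ {x | φ x ≠ 0},
        ‖radialGradient (fun t => d t + deriv h t) x‖ₑ ^ (n : ℝ) := by
    refine setLIntegral_congr_fun_ae hms ?_
    filter_upwards [hgu'] with x hx hxs
    rw [hx hxs.1, hgφ x hxs.1]
    simp only [radialGradient, ← add_smul, add_div]
  have hray : ∀ {f : ℝ → ℝ}, Measurable f →
      ∫⁻ x in annulus n ∩ {x | φ x ≠ 0}, ‖radialGradient f x‖ₑ ^ (n : ℝ) =
      (∫⁻ t in Set.Ioo (0 : ℝ) 1 ∩ {t | h t ≠ 0}, ENNReal.ofReal (|f t| ^ n)) *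
        sphereMeasure n Set.univ := by
    intro f hf
    rw [setLIntegral_ray hn hφm ((measurable_radialGradient hf).enorm.pow_const _),
      ← lintegral_const]
    refine lintegral_congr fun θ => ?_
    have e1 : ∀ t, φ (Real.exp (t - 1) • (θ : EuclideanSpace ℝ (Fin n))) = h t := fun t => by
      simp only [hφ]
      rw [exp_smul_sphere_norm, Real.log_exp, add_sub_cancel]
    simp only [e1, ofReal_pow_mul_enorm_pow (Real.exp_pos _).le, exp_mul_norm_radialGradient_ray]
  -- Both sides carry the total measure of the sphere, which is finite and nonzero and so cancels.
  rw [eL, eR, hray hdm, hray (f := fun t => d t + deriv h t) (hdm.add hdh), ← mul_assoc] at hineq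
  refine (ENNReal.mul_le_mul_iff_left ?_ (measure_ne_top _ _)).1 hineq
  exact Measure.measure_univ_ne_zero.2 (Measure.toSphere_ne_zero _)

/-! ### Power profiles and their energy -/

theorem pos_of_exponent_pos {n : ℕ} (hn : 1 ≤ n) {α : ℝ} (hα : 0 < n * α - n + 1) : 0 < α := by
  have hn1 : (1 : ℝ) ≤ n := by exact_mod_cast hn
  have : 0 < n * α := by linarith
  exact pos_of_mul_pos_right this (by linarith)

/-- Hölder's inequality for two terms. With weights `1 / n` and `1 - 1 / n`, the
arithmetic–geometric mean inequality is applied to `x ^ β, x` and to `1 - x ^ β, 1 - x`; the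
arithmetic means add up to `1`. The first geometric mean is `x ^ α` because `β / n + 1 - 1 / n = α`.
-/
theorem one_sub_rpow_mul_one_sub_pow_le {n : ℕ} (hn : 1 ≤ n) {α x : ℝ} (hα : 0 < n * α - n + 1)
    (hx0 : 0 ≤ x) (hx1 : x ≤ 1) :
    (1 - x) ^ (n - 1) * (1 - x ^ (n * α - n + 1)) ≤ (1 - x ^ α) ^ n := by
  have hn0 : (0 : ℝ) < n := by exact_mod_cast hn
  set β : ℝ := n * α - n + 1 with hβ
  have hw : (0 : ℝ) ≤ 1 - 1 / n := by
    rw [sub_nonneg, div_le_one hn0]; exact_mod_cast hn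
  have hxβ : x ^ β ≤ 1 := Real.rpow_le_one hx0 hx1 hα.le
  have hxβ0 : 0 ≤ x ^ β := Real.rpow_nonneg hx0 _
  have h1 := Real.geom_mean_le_arith_mean2_weighted (w₁ := 1 / n) (w₂ := 1 - 1 / n)
    (p₁ := 1 - x ^ β) (p₂ := 1 - x) (by positivity) hw (by linarith) (by linarith) (by ring)
  have h2 : x ^ α ≤ 1 / n * x ^ β + (1 - 1 / n) * x := by
    rcases hx0.eq_or_lt with rfl | hx
    · have hα0 : α ≠ 0 := (pos_of_exponent_pos hn hα).ne'
      rw [Real.zero_rpow hα0]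
      positivity
    · have := Real.geom_mean_le_arith_mean2_weighted (w₁ := 1 / n) (w₂ := 1 - 1 / n)
        (p₁ := x ^ β) (p₂ := x) (by positivity) hw hxβ0 hx0 (by ring)
      rw [← Real.rpow_mul hx0, ← Real.rpow_add hx] at this
      convert this using 2
      rw [hβ]
      field_simp
      ring
  have h3 : (1 - x ^ β) ^ (1 / n : ℝ) * (1 - x) ^ (1 - 1 / n : ℝ) ≤ 1 - x ^ α := by
    nlinarith
  have h4 := pow_le_pow_left₀ (mul_nonneg (Real.rpow_nonneg (by linarith) _)
    (Real.rpow_nonneg (by linarith) _)) h3 n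
  refine le_trans (le_of_eq ?_) h4
  rw [mul_pow, ← Real.rpow_natCast, ← Real.rpow_natCast _ n, ← Real.rpow_natCast _ n,
    ← Real.rpow_mul (by linarith), ← Real.rpow_mul (by linarith), one_div,
    inv_mul_cancel₀ hn0.ne', Real.rpow_one, mul_comm]
  congr 2
  rw [Nat.cast_sub hn]
  field_simp
  simp

/-- Both sides are homogeneous of degree `n * α`, so the case `x = a / b` of the preceding
inequality suffices. -/
theorem sub_pow_mul_rpow_sub_rpow_le {n : ℕ} (hn : 1 ≤ n) {α a b : ℝ} (hα : 0 < n * α - n + 1)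
    (ha : 0 ≤ a) (hab : a < b) :
    (b - a) ^ (n - 1) * (b ^ (n * α - n + 1) - a ^ (n * α - n + 1)) ≤ (b ^ α - a ^ α) ^ n := by
  have hb : 0 < b := ha.trans_lt hab
  have h := one_sub_rpow_mul_one_sub_pow_le hn hα (div_nonneg ha hb.le) ((div_le_one hb).2 hab.le)
  have hbα : (b ^ α) ^ n = b ^ (n - 1) * b ^ (n * α - n + 1) := by
    rw [← Real.rpow_natCast, ← Real.rpow_natCast, ← Real.rpow_mul hb.le, ← Real.rpow_add hb,
      Nat.cast_sub hn]
    congr 1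
    push_cast
    ring
  have h2 := mul_le_mul_of_nonneg_left h (pow_nonneg (Real.rpow_nonneg hb.le α) n)
  rw [Real.div_rpow ha hb.le, Real.div_rpow ha hb.le] at h2
  have hb1 := (Real.rpow_pos_of_pos hb α).ne'
  have hb2 := (Real.rpow_pos_of_pos hb (n * α - n + 1)).ne'
  have e1 : b ^ α * (1 - a ^ α / b ^ α) = b ^ α - a ^ α := by field_simp
  have e2 : b * (1 - a / b) = b - a := by field_simp
  have e3 : b ^ (n * α - n + 1) * (1 - a ^ (n * α - n + 1) / b ^ (n * α - n + 1)) =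
      b ^ (n * α - n + 1) - a ^ (n * α - n + 1) := by field_simp
  rw [← mul_pow, e1, hbα] at h2
  rw [← e2, ← e3, mul_pow]
  refine le_trans (le_of_eq ?_) h2
  ring

theorem hasDerivAt_rpow_energy {n : ℕ} {α t : ℝ} (hα : n * α - n + 1 ≠ 0) (ht : 0 < t) :
    HasDerivAt (fun t : ℝ => α ^ n / (n * α - n + 1) * t ^ (n * α - n + 1))
      ((α * t ^ (α - 1)) ^ n) t := by
  have h := (Real.hasDerivAt_rpow_const (p := n * α - n + 1) (Or.inl ht.ne')).const_mul
    (α ^ n / (n * α - n + 1))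
  refine h.congr_deriv ?_
  rw [mul_pow, ← Real.rpow_natCast (t ^ (α - 1)), ← Real.rpow_mul ht.le]
  have e : n * α - n + 1 - 1 = (α - 1) * n := by ring
  rw [e, ← mul_assoc, div_mul_cancel₀ _ hα]

theorem integrableOn_rpow_energy {n : ℕ} (hn : 1 ≤ n) {α : ℝ} (hα : 0 < n * α - n + 1) {a b : ℝ}
    (ha : 0 ≤ a) : IntegrableOn (fun t : ℝ => (α * t ^ (α - 1)) ^ n) (Set.Ioc a b) := by
  have hα0 := pos_of_exponent_pos hn hα
  refine intervalIntegral.integrableOn_deriv_of_nonneg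
    (g := fun t : ℝ => α ^ n / (n * α - n + 1) * t ^ (n * α - n + 1))
    (continuousOn_const.mul (continuousOn_id.rpow_const fun _ _ => Or.inr hα.le))
    (fun t ht => hasDerivAt_rpow_energy hα.ne' (ha.trans_lt ht.1)) fun t ht => ?_
  exact pow_nonneg (mul_nonneg hα0.le (Real.rpow_nonneg (ha.trans ht.1.le) _)) _

theorem integral_rpow_energy {n : ℕ} (hn : 1 ≤ n) {α : ℝ} (hα : 0 < n * α - n + 1) {a b : ℝ}
    (ha : 0 ≤ a) (hab : a ≤ b) :
    ∫ t in a..b, (α * t ^ (α - 1)) ^ n =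
      α ^ n / (n * α - n + 1) * (b ^ (n * α - n + 1) - a ^ (n * α - n + 1)) := by
  rw [intervalIntegral.integral_eq_sub_of_hasDerivAt_of_le hab
    (f := fun t : ℝ => α ^ n / (n * α - n + 1) * t ^ (n * α - n + 1))
    (continuousOn_const.mul (continuousOn_id.rpow_const fun _ _ => Or.inr hα.le))
    (fun t ht => hasDerivAt_rpow_energy hα.ne' (ha.trans_lt ht.1))
    ((intervalIntegrable_iff_integrableOn_Ioc_of_le hab).2 (integrableOn_rpow_energy hn hα ha))]
  ring

/-- The energy density has primitive `Q * t ^ (n * α - n + 1)` with this very constant `Q`, so the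
energy condition is `sub_pow_mul_rpow_sub_rpow_le` multiplied by `Q`. -/
theorem profile_rpow {n : ℕ} (hn : 1 ≤ n) {α : ℝ} (hα : 0 < n * α - n + 1) :
    Profile n (α ^ n / (n * α - n + 1)) (fun t => t ^ α) (fun t => α * t ^ (α - 1)) := by
  have hα0 := pos_of_exponent_pos hn hα
  refine ⟨continuousOn_id.rpow_const fun _ _ => Or.inr hα0.le,
    fun t ht => Real.hasDerivAt_rpow_const (Or.inl ht.1.ne'),
    fun t ht => mul_nonneg hα0.le (Real.rpow_nonneg ht.1.le _),
    continuousOn_const.mul (continuousOn_id.rpow_const fun t ht => Or.inl ht.1.ne'),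
    by fun_prop, fun a b ha hab hb => ?_⟩
  have hI := integrableOn_rpow_energy hn hα ha (b := b)
  rw [← ofReal_integral_eq_lintegral_ofReal (hI.mono_set Set.Ioo_subset_Ioc_self) ?_,
    ← integral_Ioc_eq_integral_Ioo, ← intervalIntegral.integral_of_le hab.le,
    integral_rpow_energy hn hα ha hab.le, ← ENNReal.ofReal_mul (pow_nonneg (sub_nonneg.2 hab.le) _),
    ← ENNReal.ofReal_mul (by positivity)]
  · refine ENNReal.ofReal_le_ofReal ?_
    have := mul_le_mul_of_nonneg_left (sub_pow_mul_rpow_sub_rpow_le hn hα ha hab)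
      (show 0 ≤ α ^ n / (n * α - n + 1) by positivity)
    refine le_trans (le_of_eq ?_) this
    ring
  · refine (ae_restrict_iff' measurableSet_Ioo).2 (Eventually.of_forall fun t ht => ?_)
    exact pow_nonneg (mul_nonneg hα0.le (Real.rpow_nonneg (ha.trans ht.1.le) _)) _

/-- Point reflection of the graph in `(1 / 2, 1 / 2)` preserves energies and increments; it produces
the second profile from a power. -/
theorem Profile.reflect {n : ℕ} {Q : ℝ} {U d : ℝ → ℝ} (h : Profile n Q U d) :
    Profile n Q (fun t => 1 - U (1 - t)) (fun t => d (1 - t)) := by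
  have hm : ∀ t ∈ Set.Ioo (0 : ℝ) 1, 1 - t ∈ Set.Ioo (0 : ℝ) 1 := fun t ht =>
    ⟨by linarith [ht.2], by linarith [ht.1]⟩
  refine ⟨continuousOn_const.sub (h.cont.comp (by fun_prop) fun t ht =>
      ⟨by linarith [ht.2], by linarith [ht.1]⟩),
    fun t ht => ?_, fun t ht => h.nonneg _ (hm t ht), h.contDeriv.comp (by fun_prop) hm,
    h.meas.comp (by fun_prop), fun a b ha hab hb => ?_⟩
  · have h1 : HasDerivAt (fun t : ℝ => 1 - t) (-1) t := (hasDerivAt_id t).const_sub 1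
    have := ((h.deriv _ (hm t ht)).comp t h1).const_sub 1
    simpa using this
  · have key := h.energy (1 - b) (1 - a) (by linarith) (by linarith) (by linarith)
    have e1 : ∫⁻ t in Set.Ioo a b, ENNReal.ofReal (d (1 - t) ^ n) =
        ∫⁻ t in Set.Ioo (1 - b) (1 - a), ENNReal.ofReal (d t ^ n) := by
      have := (Measure.measurePreserving_sub_left volume (1 : ℝ)).setLIntegral_comp_preimage
        (s := Set.Ioo (1 - b) (1 - a)) measurableSet_Ioo
        (f := fun t => ENNReal.ofReal (d t ^ n)) (h.meas.pow_const n).ennreal_ofReal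
      rw [← this]
      simp
    rw [e1]
    refine le_trans (le_of_eq ?_) (key.trans (le_of_eq ?_))
    · congr 3
      ring
    · congr 3
      ring

/-! ### Choice of the exponents -/

theorem exists_exponent_gt_one {n : ℕ} (hn : 2 ≤ n) {Q : ℝ} (hQ : 1 < Q) :
    ∃ α : ℝ, 1 < α ∧ Q = α ^ n / (n * α - n + 1) := by
  have hn2 : (2 : ℝ) ≤ n := by exact_mod_cast hn
  set f : ℝ → ℝ := fun α => α ^ n / (n * α - n + 1) with hf
  have hM : 1 ≤ n * Q := by nlinarith
  have hden : ∀ α : ℝ, 1 ≤ α → 0 < n * α - n + 1 := fun α hα => by nlinarith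
  have hc : ContinuousOn f (Set.Icc 1 (n * Q)) :=
    ContinuousOn.div (by fun_prop) (by fun_prop) fun α hα => (hden α hα.1).ne'
  have h1 : f 1 = 1 := by simp [hf]
  -- At `α = n * Q` the product of `Q` and the denominator is at most `(n * Q) ^ 2`, hence at most
  -- `(n * Q) ^ n` as `n ≥ 2`.
  have h2 : Q ≤ f (n * Q) := by
    rw [hf, le_div_iff₀ (hden _ hM)]
    have e1 : (n * Q) ^ 2 ≤ (n * Q) ^ n := pow_le_pow_right₀ hM hn
    have e2 : Q * (n * (n * Q) - n + 1) ≤ (n * Q) ^ 2 := by nlinarith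
    exact e2.trans e1
  obtain ⟨α, hα, hαQ⟩ := intermediate_value_Icc hM hc ⟨h1.le.trans hQ.le, h2⟩
  refine ⟨α, lt_of_le_of_ne hα.1 ?_, hαQ.symm⟩
  rintro rfl
  rw [h1] at hαQ
  exact hQ.ne hαQ

theorem exists_exponent_lt_one {n : ℕ} (hn : 2 ≤ n) {Q : ℝ} (hQ : 1 < Q) :
    ∃ α : ℝ, 1 - 1 / (n : ℝ) < α ∧ α < 1 ∧ Q = α ^ n / (n * α - n + 1) := by
  have hn2 : (2 : ℝ) ≤ n := by exact_mod_cast hn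
  set f : ℝ → ℝ := fun α => α ^ n / (n * α - n + 1) with hf
  -- At `α = 1 - 1 / n + ε` the denominator is `n * ε = (1 / 2) ^ n / Q`, while the numerator is at
  -- least `(1 / 2) ^ n` since `α ≥ 1 / 2`; so the quotient is at least `Q`.
  set ε : ℝ := (1 / 2) ^ n / (n * Q) with hε
  have hp1 : (1 / 2 : ℝ) ^ n ≤ 1 := pow_le_one₀ (by norm_num) (by norm_num)
  have hε0 : 0 < ε := by positivity
  have hε1 : ε ≤ 1 / n := by
    rw [hε, div_le_div_iff₀ (by positivity) (by positivity)]
    nlinarith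
  have hM : 1 - 1 / n + ε ≤ 1 := by linarith
  have hden : ∀ α : ℝ, 1 - 1 / n + ε ≤ α → n * ε ≤ n * α - n + 1 := fun α hα => by
    have := mul_le_mul_of_nonneg_left hα (by positivity : (0 : ℝ) ≤ n)
    have e : (n : ℝ) * (1 - 1 / n + ε) = n - 1 + n * ε := by field_simp
    linarith
  have hnε : 0 < n * ε := by positivity
  have hc : ContinuousOn f (Set.Icc (1 - 1 / n + ε) 1) :=
    ContinuousOn.div (by fun_prop) (by fun_prop) fun α hα => (hnε.trans_le (hden α hα.1)).ne'
  have h1 : f 1 = 1 := by simp [hf]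
  have h2 : Q ≤ f (1 - 1 / n + ε) := by
    have e : (n : ℝ) * (1 - 1 / n + ε) - n + 1 = n * ε := by field_simp; ring
    rw [hf]
    simp only [e]
    rw [le_div_iff₀ hnε]
    have e2 : Q * (n * ε) = (1 / 2) ^ n := by rw [hε]; field_simp
    rw [e2]
    refine pow_le_pow_left₀ (by norm_num) ?_ n
    have : 1 / (n : ℝ) ≤ 1 / 2 := one_div_le_one_div_of_le (by norm_num) hn2
    linarith
  obtain ⟨α, hα, hαQ⟩ := intermediate_value_Icc' hM hc ⟨h1.le.trans hQ.le, h2⟩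
  refine ⟨α, by linarith [hα.1], lt_of_le_of_ne hα.2 ?_, hαQ.symm⟩
  rintro rfl
  rw [h1] at hαQ
  exact hQ.ne hαQ

/-! ### Crossing of the profiles and comparison of energies -/

theorem hasDerivAt_one_sub_rpow {α t : ℝ} (ht : t < 1) :
    HasDerivAt (fun t : ℝ => 1 - (1 - t) ^ α) (α * (1 - t) ^ (α - 1)) t := by
  have h1 : HasDerivAt (fun t : ℝ => 1 - t) (-1) t := (hasDerivAt_id t).const_sub 1
  have := ((Real.hasDerivAt_rpow_const (p := α) (Or.inl (sub_pos.2 ht).ne')).comp t h1).const_sub 1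
  simpa using this

theorem continuous_rpow_of_pos {α : ℝ} (hα : 0 < α) : Continuous fun t : ℝ => t ^ α :=
  continuous_id.rpow_const fun _ => Or.inr hα.le

theorem log_combination_eq_of_deriv_eq {α₁ α₂ z : ℝ} (h1 : 1 < α₁) (h2 : 0 < α₂)
    (hz : z ∈ Set.Ioo (0 : ℝ) 1) (h : α₂ * (1 - z) ^ (α₂ - 1) - α₁ * z ^ (α₁ - 1) = 0) :
    (α₁ - 1) * Real.log z + (1 - α₂) * Real.log (1 - z) = Real.log α₂ - Real.log α₁ := by
  have hz1 : 0 < 1 - z := sub_pos.2 hz.2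
  have h3 := congrArg Real.log (sub_eq_zero.1 h)
  rw [Real.log_mul h2.ne' (Real.rpow_pos_of_pos hz1 _).ne',
    Real.log_mul (by positivity) (Real.rpow_pos_of_pos hz.1 _).ne', Real.log_rpow hz1,
    Real.log_rpow hz.1] at h3
  linarith

/-- The left-hand side is strictly concave in the variable, so it takes no value three times. -/
theorem log_combination_not_three {a b : ℝ} (ha : 0 < a) (hb : 0 < b) {x y z κ : ℝ}
    (hx : 0 < x) (hxy : x < y) (hyz : y < z) (hz : z < 1)
    (h1 : a * Real.log x + b * Real.log (1 - x) = κ)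
    (h2 : a * Real.log y + b * Real.log (1 - y) = κ)
    (h3 : a * Real.log z + b * Real.log (1 - z) = κ) : False := by
  have hzx : 0 < z - x := by linarith
  set s := (z - y) / (z - x) with hs
  set t := (y - x) / (z - x) with ht
  have hs0 : 0 < s := div_pos (by linarith) hzx
  have ht0 : 0 < t := div_pos (by linarith) hzx
  have hst : s + t = 1 := by rw [hs, ht]; field_simp; ring
  have e : s * x + t * z = y := by rw [hs, ht]; field_simp; ring
  have e' : s * (1 - x) + t * (1 - z) = 1 - y := by linear_combination hst - e
  have k1 := strictConcaveOn_log_Ioi.2 (x := x) (y := z) hx (Set.mem_Ioi.2 (by linarith))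
    (by linarith) hs0 ht0 hst
  have k2 := strictConcaveOn_log_Ioi.2 (x := 1 - x) (y := 1 - z) (Set.mem_Ioi.2 (by linarith))
    (Set.mem_Ioi.2 (by linarith)) (by intro h; linarith) hs0 ht0 hst
  simp only [smul_eq_mul] at k1 k2
  rw [e] at k1
  rw [e'] at k2
  have k3 := mul_lt_mul_of_pos_left k1 ha
  have k4 := mul_lt_mul_of_pos_left k2 hb
  have : s * (a * Real.log x + b * Real.log (1 - x)) + t * (a * Real.log z + b * Real.log (1 - z))
      = κ := by rw [h1, h3, ← add_mul, hst, one_mul]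
  nlinarith

/-- The graphs of `t ^ α₁` and `1 - (1 - t) ^ α₂` cross exactly once in `(0, 1)`. -/
theorem exists_unique_crossing {α₁ α₂ : ℝ} (h1 : 1 < α₁) (h2 : 0 < α₂) (h2' : α₂ < 1) :
    ∃ c ∈ Set.Ioo (0 : ℝ) 1, (∀ t ∈ Set.Ioo 0 c, t ^ α₁ < 1 - (1 - t) ^ α₂) ∧
      c ^ α₁ = 1 - (1 - c) ^ α₂ ∧
      ∀ t ∈ Set.Ioo c 1, 1 - (1 - t) ^ α₂ < t ^ α₁ := by
  set D : ℝ → ℝ := fun t => 1 - (1 - t) ^ α₂ - t ^ α₁ with hD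
  have hDc : Continuous D :=
    (continuous_const.sub ((continuous_rpow_of_pos h2).comp (continuous_const.sub continuous_id))).sub
      (continuous_rpow_of_pos (by linarith))
  have hD0 : D 0 = 0 := by simp [hD, Real.zero_rpow (by linarith : α₁ ≠ 0)]
  have hD1 : D 1 = 0 := by simp [hD, Real.zero_rpow h2.ne']
  have hDd : ∀ t ∈ Set.Ioo (0 : ℝ) 1,
      HasDerivAt D (α₂ * (1 - t) ^ (α₂ - 1) - α₁ * t ^ (α₁ - 1)) t := fun t ht =>
    (hasDerivAt_one_sub_rpow ht.2).sub (Real.hasDerivAt_rpow_const (Or.inl ht.1.ne'))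
  -- Two interior zeros, with the zeros at `0` and `1`, would give three critical points by Rolle;
  -- the logarithm of the critical equation admits at most two.
  have huniq : ∀ x y, 0 < x → x < y → y < 1 → D x = 0 → D y = 0 → False := by
    intro x y hx hxy hy hDx hDy
    obtain ⟨z1, hz1, e1⟩ := exists_hasDerivAt_eq_zero hx hDc.continuousOn (hD0.trans hDx.symm)
      fun t ht => hDd t ⟨ht.1, by linarith [ht.2]⟩
    obtain ⟨z2, hz2, e2⟩ := exists_hasDerivAt_eq_zero hxy hDc.continuousOn (hDx.trans hDy.symm)
      fun t ht => hDd t ⟨by linarith [ht.1], by linarith [ht.2]⟩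
    obtain ⟨z3, hz3, e3⟩ := exists_hasDerivAt_eq_zero hy hDc.continuousOn (hDy.trans hD1.symm)
      fun t ht => hDd t ⟨by linarith [ht.1], by linarith [ht.2]⟩
    refine log_combination_not_three (sub_pos.2 h1) (sub_pos.2 h2') hz1.1 (hz1.2.trans hz2.1)
      (hz2.2.trans hz3.1) hz3.2
      (log_combination_eq_of_deriv_eq h1 h2 ⟨hz1.1, by linarith [hz1.2]⟩ e1)
      (log_combination_eq_of_deriv_eq h1 h2 ⟨by linarith [hz2.1], by linarith [hz2.2]⟩ e2)
      (log_combination_eq_of_deriv_eq h1 h2 ⟨by linarith [hz3.1], hz3.2⟩ e3)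
  have hsmall : ∀ γ δ : ℝ, 0 < γ → 0 < δ → ∃ t ∈ Set.Ioo (0 : ℝ) 1, ∀ s ∈ Set.Ioc 0 t, s ^ γ < δ := by
    intro γ δ hγ hδ
    have hcont := (continuous_rpow_of_pos hγ).tendsto 0
    rw [Real.zero_rpow hγ.ne'] at hcont
    have := (tendsto_nhdsWithin_of_tendsto_nhds (s := Set.Ioi 0) hcont).eventually (gt_mem_nhds hδ)
    obtain ⟨t, ht, ht'⟩ := (this.and (Ioo_mem_nhdsGT zero_lt_one)).exists
    exact ⟨t, ht', fun s hs => (Real.rpow_le_rpow hs.1.le hs.2 hγ.le).trans_lt ht⟩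
  -- Near `0`, Bernoulli gives `1 - (1 - t) ^ α₂ ≥ α₂ * t`, which beats `t ^ α₁` as `α₁ > 1`.
  obtain ⟨t0, ht0, hDt0⟩ : ∃ t ∈ Set.Ioo (0 : ℝ) 1, ∀ s ∈ Set.Ioc 0 t, 0 < D s := by
    obtain ⟨t₁, ht₁, hs⟩ := hsmall (α₁ - 1) α₂ (sub_pos.2 h1) h2
    refine ⟨t₁, ht₁, fun t ht' => ?_⟩
    have h := hs t ht'
    have ht : t ∈ Set.Ioo (0 : ℝ) 1 := ⟨ht'.1, ht'.2.trans_lt ht₁.2⟩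
    have e1 : t ^ α₁ = t * t ^ (α₁ - 1) := by
      rw [← Real.rpow_one_add' ht.1.le (by linarith)]; congr 1; ring
    have e2 := rpow_one_add_le_one_add_mul_self (s := -t) (by linarith [ht.2]) h2.le h2'.le
    have e3 : (1 - t) ^ α₂ ≤ 1 - α₂ * t := by
      refine le_trans (le_of_eq ?_) (e2.trans (le_of_eq ?_)) <;> ring_nf
    have e4 := mul_lt_mul_of_pos_left h ht.1
    simp only [hD]
    rw [e1]
    linarith
  -- At `1 - s`, Bernoulli gives `D ≤ α₁ * s - s ^ α₂`, negative for small `s` as `α₂ < 1`.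
  obtain ⟨s0, hs0, hDs0⟩ : ∃ t ∈ Set.Ioo (0 : ℝ) 1, D t < 0 := by
    obtain ⟨s, hs, h'⟩ := hsmall (1 - α₂) (1 / α₁) (sub_pos.2 h2') (by positivity)
    have h := h' s ⟨hs.1, le_rfl⟩
    refine ⟨1 - s, ⟨by linarith [hs.2], by linarith [hs.1]⟩, ?_⟩
    have e1 : s = s ^ α₂ * s ^ (1 - α₂) := by
      rw [← Real.rpow_add hs.1]; simp
    have e2 := one_add_mul_self_le_rpow_one_add (s := -s) (by linarith [hs.2]) h1.le
    have e3 : 1 - α₁ * s ≤ (1 - s) ^ α₁ := by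
      refine le_trans (le_of_eq ?_) (e2.trans (le_of_eq ?_)) <;> ring_nf
    have e4 : α₁ * s ^ (1 - α₂) < 1 := by
      rw [lt_div_iff₀ (by positivity)] at h
      linarith
    have e5 := mul_lt_mul_of_pos_left e4 (Real.rpow_pos_of_pos hs.1 α₂)
    have e6 : s ^ α₂ * (α₁ * s ^ (1 - α₂)) = α₁ * s := by
      conv_rhs => rw [e1]
      ring
    simp only [hD, sub_sub_cancel]
    linarith
  have hzero : ∀ x y, x ∈ Set.Ioo (0 : ℝ) 1 → y ∈ Set.Ioo (0 : ℝ) 1 → 0 < D x → D y < 0 →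
      ∃ z ∈ Set.Ioo (0 : ℝ) 1, D z = 0 ∧ (x < z ∧ z < y ∨ y < z ∧ z < x) := by
    intro x y hx hy hDx hDy
    have hxy : x ≠ y := by rintro rfl; linarith
    rcases hxy.lt_or_gt with h | h
    · obtain ⟨z, hz, hz0⟩ := intermediate_value_Ioo' h.le hDc.continuousOn ⟨hDy, hDx⟩
      exact ⟨z, ⟨hx.1.trans hz.1, hz.2.trans hy.2⟩, hz0, Or.inl hz⟩
    · obtain ⟨z, hz, hz0⟩ := intermediate_value_Ioo h.le hDc.continuousOn ⟨hDy, hDx⟩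
      exact ⟨z, ⟨hy.1.trans hz.1, hz.2.trans hx.2⟩, hz0, Or.inr hz⟩
  have hD0' := hDt0 t0 ⟨ht0.1, le_rfl⟩
  have hts : t0 < s0 := by
    by_contra h
    exact lt_asymm hDs0 (hDt0 s0 ⟨hs0.1, not_lt.1 h⟩)
  obtain ⟨c, hc, hDc0, hc'⟩ := hzero t0 s0 ht0 hs0 hD0' hDs0
  have hc'' : t0 < c ∧ c < s0 := hc'.resolve_right fun h => by linarith [h.1, h.2]
  refine ⟨c, hc, fun t ht => ?_, ?_, fun t ht => ?_⟩
  · have htI : t ∈ Set.Ioo (0 : ℝ) 1 := ⟨ht.1, ht.2.trans hc.2⟩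
    -- A wrong sign at `t` would produce, by the intermediate value theorem, a second zero besides
    -- `c`.
    rcases lt_trichotomy (D t) 0 with h | h | h
    · obtain ⟨z, hz, hz0, hz'⟩ := hzero t0 t ht0 htI hD0' h
      refine (huniq z c hz.1 ?_ hc.2 hz0 hDc0).elim
      rcases hz' with h | h
      · exact h.2.trans ht.2
      · exact h.2.trans hc''.1
    · exact (huniq t c ht.1 ht.2 hc.2 h hDc0).elim
    · exact sub_pos.1 h
  · simp only [hD] at hDc0
    linarith
  · have htI : t ∈ Set.Ioo (0 : ℝ) 1 := ⟨hc.1.trans ht.1, ht.2⟩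
    rcases lt_trichotomy (D t) 0 with h | h | h
    · exact sub_neg.1 h
    · exact (huniq c t hc.1 ht.1 ht.2 hDc0 h).elim
    · obtain ⟨z, hz, hz0, hz'⟩ := hzero t s0 htI hs0 h hDs0
      refine (huniq c z hc.1 ?_ hz.2 hDc0 hz0).elim
      rcases hz' with h | h
      · exact ht.1.trans h.1
      · exact hc''.2.trans h.1

/-- The tangent-line inequality at `d2` bounds `∫ d1 ^ n` below by `∫ d2 ^ n - n ∫ d2 ^ (n - 1) *
D'`, where `D` is the second profile minus the first. Since `D` vanishes at `0` and `c`, integration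
by parts makes the correction `n ∫ (d2 ^ (n - 1))' * D`. It is positive: `d2` increases by
convexity, and `D > 0` inside. -/
theorem integral_deriv_pow_lt {n : ℕ} (hn : 2 ≤ n) {α₁ α₂ c : ℝ} (h1 : 1 < α₁) (h2 : 0 < α₂)
    (h2' : α₂ < 1) (hc0 : 0 < c) (hc1 : c < 1) (hlt : ∀ t ∈ Set.Ioo 0 c, t ^ α₁ < 1 - (1 - t) ^ α₂)
    (hc : c ^ α₁ = 1 - (1 - c) ^ α₂) :
    ∫ t in (0 : ℝ)..c, (α₂ * (1 - t) ^ (α₂ - 1)) ^ n <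
      ∫ t in (0 : ℝ)..c, (α₁ * t ^ (α₁ - 1)) ^ n := by
  obtain ⟨m, rfl⟩ : ∃ m, n = m + 2 := ⟨n - 2, by omega⟩
  set d1 : ℝ → ℝ := fun t => α₁ * t ^ (α₁ - 1) with hd1
  set d2 : ℝ → ℝ := fun t => α₂ * (1 - t) ^ (α₂ - 1) with hd2
  set D : ℝ → ℝ := fun t => 1 - (1 - t) ^ α₂ - t ^ α₁ with hD
  have hmem : ∀ t ∈ Set.uIcc 0 c, 0 ≤ t ∧ t < 1 := fun t ht => by
    rw [Set.uIcc_of_le hc0.le] at ht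
    exact ⟨ht.1, ht.2.trans_lt hc1⟩
  have hrc : ∀ γ : ℝ, ContinuousOn (fun t : ℝ => (1 - t) ^ γ) (Set.uIcc 0 c) := fun γ =>
    ContinuousOn.rpow_const (by fun_prop) fun t ht => Or.inl (sub_pos.2 (hmem t ht).2).ne'
  have hd1c : ContinuousOn d1 (Set.uIcc 0 c) :=
    (continuous_const.mul (continuous_rpow_of_pos (sub_pos.2 h1))).continuousOn
  have hd2c : ContinuousOn d2 (Set.uIcc 0 c) := continuousOn_const.mul (hrc _)
  have hDd : ∀ t ∈ Set.uIcc 0 c, HasDerivAt D (d2 t - d1 t) t := fun t ht =>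
    (hasDerivAt_one_sub_rpow (hmem t ht).2).sub (Real.hasDerivAt_rpow_const (Or.inr h1.le))
  set w' : ℝ → ℝ := fun t =>
    (m + 1 : ℕ) * d2 t ^ m * (α₂ * (1 - α₂) * (1 - t) ^ (α₂ - 2)) with hw'
  have hwd : ∀ t ∈ Set.uIcc 0 c, HasDerivAt (fun t => d2 t ^ (m + 1)) (w' t) t := by
    intro t ht
    have ht1 : HasDerivAt (fun t : ℝ => 1 - t) (-1) t := (hasDerivAt_id t).const_sub 1
    have h := (((Real.hasDerivAt_rpow_const (p := α₂ - 1)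
      (Or.inl (sub_pos.2 (hmem t ht).2).ne')).comp t ht1).const_mul α₂).pow (m + 1)
    refine h.congr_deriv ?_
    simp only [hw', hd2, Nat.add_sub_cancel, Function.comp_apply]
    have : α₂ - 1 - 1 = α₂ - 2 := by ring
    rw [this]
    ring
  have hw'c : ContinuousOn w' (Set.uIcc 0 c) :=
    (continuousOn_const.mul (hd2c.pow _)).mul (continuousOn_const.mul (hrc _))
  have hparts := intervalIntegral.integral_mul_deriv_eq_deriv_mul hwd hDd
    hw'c.intervalIntegrable (hd2c.sub hd1c).intervalIntegrable
  have hD0 : D 0 = 0 := by simp [hD, Real.zero_rpow (by linarith : α₁ ≠ 0)]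
  have hDc : D c = 0 := by simp only [hD]; linarith
  rw [hD0, hDc, mul_zero, mul_zero, sub_zero, zero_sub] at hparts
  have hDcont : ContinuousOn D (Set.uIcc 0 c) := fun t ht =>
    (hDd t ht).continuousAt.continuousWithinAt
  have hpos : 0 < ∫ t in (0 : ℝ)..c, w' t * D t := by
    refine intervalIntegral.intervalIntegral_pos_of_pos_on
      (hw'c.mul hDcont).intervalIntegrable (fun t ht => ?_) hc0
    have ht1 : 0 < 1 - t := by linarith [ht.2]
    have : 0 < D t := by have := hlt t ht; simp only [hD]; linarith
    have : 0 < 1 - α₂ := by linarith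
    have : 0 < (1 - t) ^ (α₂ - 2) := Real.rpow_pos_of_pos ht1 _
    have : 0 < (1 - t) ^ (α₂ - 1) := Real.rpow_pos_of_pos ht1 _
    positivity
  have hmono : ∫ t in (0 : ℝ)..c, (d2 t ^ (m + 2) -
      (m + 2 : ℕ) * (d2 t ^ (m + 1) * (d2 t - d1 t))) ≤ ∫ t in (0 : ℝ)..c, d1 t ^ (m + 2) := by
    refine intervalIntegral.integral_mono_on hc0.le ?_ ?_ fun t ht => ?_
    · exact ((hd2c.pow _).sub (continuousOn_const.mul ((hd2c.pow _).mul
        (hd2c.sub hd1c)))).intervalIntegrable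
    · exact (hd1c.pow _).intervalIntegrable
    · have ht1 : 0 < 1 - t := by linarith [ht.2]
      have e1 : 0 ≤ d2 t := mul_nonneg h2.le (Real.rpow_nonneg ht1.le _)
      have e2 : 0 ≤ d1 t := mul_nonneg (by linarith) (Real.rpow_nonneg ht.1 _)
      have := pow_add_mul_sub_le_abs_pow (n := m + 2) (by omega) e1 (d1 t)
      rw [abs_of_nonneg e2] at this
      refine le_trans (le_of_eq ?_) this
      simp only [Nat.add_succ_sub_one]
      ring
  have hA : IntervalIntegrable (fun t => d2 t ^ (m + 2)) volume 0 c :=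
    (hd2c.pow _).intervalIntegrable
  have hB : IntervalIntegrable (fun t => (m + 2 : ℕ) * (d2 t ^ (m + 1) * (d2 t - d1 t)))
      volume 0 c :=
    (continuousOn_const.mul ((hd2c.pow _).mul (hd2c.sub hd1c))).intervalIntegrable
  rw [intervalIntegral.integral_sub hA hB, intervalIntegral.integral_const_mul, hparts] at hmono
  have : (0 : ℝ) < (m + 2 : ℕ) := by positivity
  nlinarith

/-! ### Smooth approximation of the test function -/

/-- A smooth nonnegative function which vanishes on `(-∞, 1]` and is the identity on
`[2, ∞)`. -/
noncomputable def smoothPos (s : ℝ) : ℝ := s * Real.smoothTransition (s - 1)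

theorem contDiff_smoothPos : ContDiff ℝ ∞ smoothPos :=
  contDiff_id.mul (Real.smoothTransition.contDiff.comp (contDiff_id.sub contDiff_const))

theorem smoothPos_of_le_one {s : ℝ} (hs : s ≤ 1) : smoothPos s = 0 := by
  rw [smoothPos, Real.smoothTransition.zero_of_nonpos (by linarith), mul_zero]

theorem smoothPos_of_two_le {s : ℝ} (hs : 2 ≤ s) : smoothPos s = s := by
  rw [smoothPos, Real.smoothTransition.one_of_one_le (by linarith), mul_one]

theorem smoothPos_nonneg (s : ℝ) : 0 ≤ smoothPos s := by
  rcases le_total s 1 with h | h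
  · exact (smoothPos_of_le_one h).ge
  · exact mul_nonneg (by linarith) (Real.smoothTransition.nonneg _)

theorem deriv_smoothPos_of_lt_one {s : ℝ} (hs : s < 1) : deriv smoothPos s = 0 := by
  have : smoothPos =ᶠ[𝓝 s] fun _ => 0 := by
    filter_upwards [gt_mem_nhds hs] with x hx using smoothPos_of_le_one hx.le
  rw [this.deriv_eq, deriv_const]

theorem deriv_smoothPos_of_two_lt {s : ℝ} (hs : 2 < s) : deriv smoothPos s = 1 := by
  have : smoothPos =ᶠ[𝓝 s] fun x => x := by
    filter_upwards [lt_mem_nhds hs] with x hx using smoothPos_of_two_le hx.le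
  rw [this.deriv_eq, deriv_id'']

theorem exists_bound_deriv_smoothPos : ∃ C : ℝ, 1 ≤ C ∧ ∀ s, |deriv smoothPos s| ≤ C := by
  obtain ⟨C, hC⟩ := (isCompact_Icc (a := (0 : ℝ)) (b := 3)).exists_bound_of_continuousOn
    (contDiff_smoothPos.continuous_deriv (by simp)).continuousOn
  refine ⟨max C 1, le_max_right _ _, fun s => ?_⟩
  rcases lt_or_ge s 1 with h | h
  · rw [deriv_smoothPos_of_lt_one h, abs_zero]; positivity
  rcases lt_or_ge 2 s with h' | h'
  · rw [deriv_smoothPos_of_two_lt h', abs_one]; exact le_max_right _ _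
  · exact (hC s ⟨by linarith, by linarith⟩).trans (le_max_left _ _)

/-- The rescaling of `smoothPos` whose transition takes place in `[1 / k, 2 / k]`. -/
noncomputable def scaledPos (k s : ℝ) : ℝ := smoothPos (k * s) / k

theorem contDiff_scaledPos (k : ℝ) : ContDiff ℝ ∞ (scaledPos k) :=
  (contDiff_smoothPos.comp (contDiff_const.mul contDiff_id)).div_const k

/-- Rescaling does not change the range of slopes, so the bound on `deriv smoothPos` holds uniformly
in `k`. -/
theorem hasDerivAt_scaledPos {k : ℝ} (hk : k ≠ 0) (s : ℝ) :
    HasDerivAt (scaledPos k) (deriv smoothPos (k * s)) s := by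
  have h1 : HasDerivAt (fun s : ℝ => k * s) k s := by
    simpa using (hasDerivAt_id s).const_mul k
  have h2 := ((contDiff_smoothPos.differentiable (by simp) (k * s)).hasDerivAt.comp s h1).div_const k
  exact h2.congr_deriv (by field_simp)

theorem scaledPos_nonneg {k : ℝ} (hk : 0 < k) (s : ℝ) : 0 ≤ scaledPos k s :=
  div_nonneg (smoothPos_nonneg _) hk.le

theorem scaledPos_of_mul_le_one {k s : ℝ} (h : k * s ≤ 1) : scaledPos k s = 0 := by
  rw [scaledPos, smoothPos_of_le_one h, zero_div]

theorem scaledPos_of_two_le_mul {k s : ℝ} (hk : k ≠ 0) (h : 2 ≤ k * s) : scaledPos k s = s := by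
  rw [scaledPos, smoothPos_of_two_le h]
  field_simp

/-- Since `q ≤ 0` at both ends, the set where `q ≥ 1 / k` is a compact subset of the open interval,
and off it `scaledPos k` kills `q`. -/
theorem indicator_scaledPos_isTest {q : ℝ → ℝ} (hq : ContinuousOn q (Set.Icc 0 1))
    (hqs : ContDiffOn ℝ ∞ q (Set.Ioo 0 1)) (h0 : q 0 ≤ 0) (h1 : q 1 ≤ 0) {k : ℝ} (hk : 0 < k) :
    ContDiff ℝ ∞ ((Set.Ioo (0 : ℝ) 1).indicator fun t => scaledPos k (q t)) ∧
    HasCompactSupport ((Set.Ioo (0 : ℝ) 1).indicator fun t => scaledPos k (q t)) ∧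
    tsupport ((Set.Ioo (0 : ℝ) 1).indicator fun t => scaledPos k (q t)) ⊆ Set.Ioo 0 1 := by
  set h := (Set.Ioo (0 : ℝ) 1).indicator fun t => scaledPos k (q t) with hh
  set K : Set ℝ := Set.Icc 0 1 ∩ q ⁻¹' Set.Ici (1 / k) with hK
  have hKc : IsCompact K := isCompact_Icc.of_isClosed_subset
    (hq.preimage_isClosed_of_isClosed isClosed_Icc isClosed_Ici) Set.inter_subset_left
  have hk' : 0 < 1 / k := by positivity
  have hKs : K ⊆ Set.Ioo 0 1 := by
    rintro t ⟨ht, htq⟩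
    have htq' : 1 / k ≤ q t := htq
    refine ⟨lt_of_le_of_ne ht.1 ?_, lt_of_le_of_ne ht.2 ?_⟩
    · rintro rfl; linarith
    · rintro rfl; linarith
  have hz : ∀ t, t ∉ K → h t = 0 := by
    intro t ht
    by_cases htI : t ∈ Set.Ioo (0 : ℝ) 1
    · rw [hh, Set.indicator_of_mem htI]
      apply scaledPos_of_mul_le_one
      by_contra hcon
      refine ht ⟨Set.Ioo_subset_Icc_self htI, ?_⟩
      rw [Set.mem_preimage, Set.mem_Ici, div_le_iff₀ hk]
      linarith
    · rw [hh, Set.indicator_of_notMem htI]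
  refine ⟨contDiff_iff_contDiffAt.2 fun t => ?_, HasCompactSupport.intro hKc hz,
    (closure_minimal (fun t ht => ?_) hKc.isClosed).trans hKs⟩
  · by_cases htK : t ∈ K
    · have hn : Set.Ioo (0 : ℝ) 1 ∈ 𝓝 t := isOpen_Ioo.mem_nhds (hKs htK)
      have := (contDiff_scaledPos k).contDiffAt.comp t (hqs.contDiffAt hn)
      refine this.congr_of_eventuallyEq ?_
      filter_upwards [hn] with s hs
      rw [hh, Set.indicator_of_mem hs, Function.comp_apply]
    · have : h =ᶠ[𝓝 t] fun _ => 0 := by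
        filter_upwards [hKc.isClosed.isOpen_compl.mem_nhds htK] with s hs using hz s hs
      exact contDiffAt_const.congr_of_eventuallyEq this
  · by_contra h'
    exact ht (hz t h')

theorem add_three_pow_le {a b : ℝ} (ha : 0 ≤ a) (hb : 0 ≤ b) (n : ℕ) :
    (1 + a + b) ^ n ≤ 3 ^ n * (1 + a ^ n + b ^ n) := by
  have h1 : 1 + a + b ≤ 3 * max 1 (max a b) := by
    have e1 := le_max_left 1 (max a b)
    have e2 := (le_max_left a b).trans (le_max_right 1 (max a b))
    have e3 := (le_max_right a b).trans (le_max_right 1 (max a b))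
    linarith
  refine (pow_le_pow_left₀ (by positivity) h1 n).trans ?_
  rw [mul_pow]
  gcongr
  have p1 := pow_nonneg ha n
  have p2 := pow_nonneg hb n
  rcases max_choice 1 (max a b) with h | h
  · rw [h, one_pow]; linarith
  · rw [h]
    rcases max_choice a b with h | h <;> rw [h] <;> linarith

/-- If a function which is the minimum of two functions crossing at `c`, lies below the diagonal
and joins `(0, 0)` to `(1, 1)` satisfies the one-dimensional `Q`-quasisuperminimizing inequality
for smooth test functions, then its energy is at most `Q`, the factor `Q` times that of the
diagonal. -/
theorem lintegral_deriv_min_le {n : ℕ} {Q c : ℝ} {u₁ u₂ d₁ d₂ : ℝ → ℝ}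
    (hu₁ : ContinuousOn u₁ (Set.Icc 0 1)) (hu₂ : ContinuousOn u₂ (Set.Icc 0 1))
    (hs₁ : ContDiffOn ℝ ∞ u₁ (Set.Ioo 0 1)) (hs₂ : ContDiffOn ℝ ∞ u₂ (Set.Ioo 0 1))
    (hd₁ : ∀ t ∈ Set.Ioo (0 : ℝ) 1, HasDerivAt u₁ (d₁ t) t)
    (hd₂ : ∀ t ∈ Set.Ioo (0 : ℝ) 1, HasDerivAt u₂ (d₂ t) t)
    (hm₁ : Measurable d₁) (hm₂ : Measurable d₂)
    (hn₁ : ∀ t ∈ Set.Ioo (0 : ℝ) 1, 0 ≤ d₁ t) (hn₂ : ∀ t ∈ Set.Ioo (0 : ℝ) 1, 0 ≤ d₂ t)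
    (hi₁ : IntegrableOn (fun t => d₁ t ^ n) (Set.Ioo 0 1))
    (hi₂ : IntegrableOn (fun t => d₂ t ^ n) (Set.Ioo 0 1))
    (h0 : u₁ 0 = 0) (h0' : u₂ 0 = 0) (h1 : u₁ 1 = 1) (h1' : u₂ 1 = 1)
    (hlt : ∀ t ∈ Set.Ioo 0 c, u₁ t < u₂ t) (hgt : ∀ t ∈ Set.Ioo c 1, u₂ t < u₁ t)
    (hdiag : ∀ t ∈ Set.Ioo (0 : ℝ) 1, u₁ t < t)
    (hquasi : ∀ h : ℝ → ℝ, ContDiff ℝ ∞ h → HasCompactSupport h → tsupport h ⊆ Set.Ioo 0 1 →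
      (∀ t, 0 ≤ h t) →
      ∫⁻ t in Set.Ioo (0 : ℝ) 1 ∩ {t | h t ≠ 0},
        ENNReal.ofReal (|if t < c then d₁ t else d₂ t| ^ n) ≤
      ENNReal.ofReal Q * ∫⁻ t in Set.Ioo (0 : ℝ) 1 ∩ {t | h t ≠ 0},
        ENNReal.ofReal (|(if t < c then d₁ t else d₂ t) + deriv h t| ^ n)) :
    ∫⁻ t in Set.Ioo (0 : ℝ) 1, ENNReal.ofReal (|if t < c then d₁ t else d₂ t| ^ n) ≤
      ENNReal.ofReal Q := by
  set d : ℝ → ℝ := fun t => if t < c then d₁ t else d₂ t with hd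
  have hdm : Measurable d := Measurable.ite measurableSet_Iio hm₁ hm₂
  obtain ⟨C, hC1, hC⟩ := exists_bound_deriv_smoothPos
  -- Because `min u₁ u₂ = u₂ - (u₂ - u₁)⁺`, this is a smooth version of the diagonal minus the
  -- minimum; a second truncation in `h` makes it compactly supported and nonnegative.
  set q : ℕ → ℝ → ℝ := fun j t => t - (u₂ t - scaledPos (j + 1) (u₂ t - u₁ t)) with hq
  set h : ℕ → ℝ → ℝ := fun j =>
    (Set.Ioo (0 : ℝ) 1).indicator fun t => scaledPos (j + 1) (q j t) with hh
  have hk : ∀ j : ℕ, (0 : ℝ) < j + 1 := fun j => by positivity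
  have hz : ∀ j : ℕ, scaledPos (j + 1 : ℝ) 0 = 0 := fun j =>
    scaledPos_of_mul_le_one (by simp)
  have htest := fun j : ℕ => indicator_scaledPos_isTest (q := q j)
    (continuousOn_id.sub (hu₂.sub ((contDiff_scaledPos _).continuous.comp_continuousOn
      (hu₂.sub hu₁))))
    (contDiffOn_id.sub (hs₂.sub ((contDiff_scaledPos _).comp_contDiffOn (hs₂.sub hs₁))))
    (by simp [hq, h0, h0', hz]) (by simp [hq, h1, h1', hz]) (hk j)
  have hnn : ∀ j t, 0 ≤ h j t := fun j t =>
    Set.indicator_nonneg (fun t _ => scaledPos_nonneg (hk j) _) t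
  have hhm : ∀ j, Measurable (h j) := fun j => (htest j).1.continuous.measurable
  have hder : ∀ j, ∀ t ∈ Set.Ioo (0 : ℝ) 1, deriv (h j) t =
      deriv smoothPos ((j + 1) * q j t) *
        (1 - (d₂ t - deriv smoothPos ((j + 1) * (u₂ t - u₁ t)) * (d₂ t - d₁ t))) := by
    intro j t ht
    have e1 : h j =ᶠ[𝓝 t] fun t => scaledPos (j + 1) (q j t) := by
      filter_upwards [isOpen_Ioo.mem_nhds ht] with s hs
      simp only [hh, Set.indicator_of_mem hs]
    rw [e1.deriv_eq]
    have e2 := (hasDerivAt_scaledPos (hk j).ne' (u₂ t - u₁ t)).comp t ((hd₂ t ht).sub (hd₁ t ht))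
    have e3 := (hasDerivAt_id t).sub ((hd₂ t ht).sub e2)
    exact ((hasDerivAt_scaledPos (hk j).ne' (q j t)).comp t e3).deriv
  have hbound : ∀ j, ∀ t ∈ Set.Ioo (0 : ℝ) 1,
      |d t + deriv (h j) t| ≤ 3 * C ^ 2 * (1 + d₁ t + d₂ t) := by
    intro j t ht
    rw [hder j t ht]
    have a1 := hn₁ t ht
    have a2 := hn₂ t ht
    set A := deriv smoothPos ((j + 1) * q j t)
    set B := deriv smoothPos ((j + 1) * (u₂ t - u₁ t))
    have hA : |A| ≤ C := hC _
    have hB : |B| ≤ C := hC _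
    have b0 : |d t| ≤ d₁ t + d₂ t := by
      simp only [hd]
      split_ifs <;> rw [abs_of_nonneg (by assumption)] <;> linarith
    have b1 : |d₂ t - d₁ t| ≤ d₁ t + d₂ t := by rw [abs_le]; constructor <;> linarith
    have b2 : |B * (d₂ t - d₁ t)| ≤ C * (d₁ t + d₂ t) := by
      rw [abs_mul]; exact mul_le_mul hB b1 (abs_nonneg _) (by linarith)
    have b3 : |1 - (d₂ t - B * (d₂ t - d₁ t))| ≤ 1 + d₂ t + C * (d₁ t + d₂ t) := by
      rw [abs_le] at b2 ⊢
      constructor <;> linarith [b2.1, b2.2]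
    have b4 : |A * (1 - (d₂ t - B * (d₂ t - d₁ t)))| ≤ C * (1 + d₂ t + C * (d₁ t + d₂ t)) := by
      rw [abs_mul]; exact mul_le_mul hA b3 (abs_nonneg _) (by linarith)
    have b5 := abs_add_le (d t) (A * (1 - (d₂ t - B * (d₂ t - d₁ t))))
    have c1 : C ≤ C ^ 2 := by nlinarith
    have c2 : 1 ≤ C ^ 2 := by nlinarith
    have c3 : C * (1 + d₂ t) ≤ C ^ 2 * (1 + d₂ t) := mul_le_mul_of_nonneg_right c1 (by linarith)
    have c4 : d₁ t + d₂ t ≤ C ^ 2 * (d₁ t + d₂ t) := le_mul_of_one_le_left (by linarith) c2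
    have c5 : 0 ≤ C ^ 2 * d₁ t := by positivity
    nlinarith
  have hset : ∀ j, MeasurableSet {t | h j t ≠ 0} := fun j =>
    hhm j (measurableSet_singleton 0).compl
  -- Away from the kink both truncations are eventually inactive or complete, so the competitor has
  -- the slope of the diagonal.
  have hae : ∀ t ∈ Set.Ioo (0 : ℝ) 1, t ≠ c →
      ∀ᶠ j : ℕ in atTop, h j t ≠ 0 ∧ d t + deriv (h j) t = 1 := by
    intro t ht htc
    have hlarge : ∀ ε : ℝ, 0 < ε → ∀ᶠ j : ℕ in atTop, 2 < ((j : ℝ) + 1) * ε := by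
      intro ε hε
      filter_upwards [eventually_gt_atTop ⌈2 / ε⌉₊] with j hj
      have := (Nat.le_ceil (2 / ε)).trans_lt (Nat.cast_lt.2 hj)
      rw [div_lt_iff₀ hε] at this
      nlinarith
    rcases htc.lt_or_gt with htc | htc
    · have e1 := sub_pos.2 (hlt t ⟨ht.1, htc⟩)
      have e2 := sub_pos.2 (hdiag t ht)
      filter_upwards [hlarge _ e1, hlarge _ e2] with j j1 j2
      have hqj : q j t = t - u₁ t := by
        simp only [hq]
        rw [scaledPos_of_two_le_mul (hk j).ne' j1.le]
        ring
      refine ⟨?_, ?_⟩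
      · simp only [hh, Set.indicator_of_mem ht, hqj]
        rw [scaledPos_of_two_le_mul (hk j).ne' j2.le]
        exact e2.ne'
      · rw [hder j t ht, hqj, deriv_smoothPos_of_two_lt j1, deriv_smoothPos_of_two_lt j2]
        simp only [hd, if_pos htc]
        ring
    · have e1 := hgt t ⟨htc, ht.2⟩
      have e2 : 0 < t - u₂ t := by linarith [hdiag t ht]
      filter_upwards [hlarge _ e2] with j j2
      have j1 : ((j : ℝ) + 1) * (u₂ t - u₁ t) < 1 := by
        have := mul_pos (hk j) (sub_pos.2 e1)
        nlinarith
      have hqj : q j t = t - u₂ t := by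
        simp only [hq]
        rw [scaledPos_of_mul_le_one j1.le, sub_zero]
      refine ⟨?_, ?_⟩
      · simp only [hh, Set.indicator_of_mem ht, hqj]
        rw [scaledPos_of_two_le_mul (hk j).ne' j2.le]
        exact e2.ne'
      · rw [hder j t ht, hqj, deriv_smoothPos_of_lt_one j1, deriv_smoothPos_of_two_lt j2]
        simp only [hd, if_neg htc.le.not_gt]
        ring
  have hae' : ∀ᵐ t ∂(volume.restrict (Set.Ioo (0 : ℝ) 1)),
      ∀ᶠ j : ℕ in atTop, h j t ≠ 0 ∧ d t + deriv (h j) t = 1 := by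
    rw [ae_restrict_iff' measurableSet_Ioo]
    filter_upwards [Measure.ae_ne volume c] with t ht htI using hae t htI ht
  -- A majorant independent of `j`; the power `C ^ 2` accounts for the two nested truncations.
  set B : ℝ → ℝ≥0∞ := fun t =>
    ENNReal.ofReal ((3 * C ^ 2) ^ n * (3 ^ n * (1 + d₁ t ^ n + d₂ t ^ n))) with hB
  have hBfin : ∫⁻ t in Set.Ioo (0 : ℝ) 1, B t ≠ ⊤ := by
    have h1I : IntegrableOn (fun _ : ℝ => (1 : ℝ)) (Set.Ioo 0 1) := by simp
    have : IntegrableOn (fun t => (3 * C ^ 2) ^ n * (3 ^ n * (1 + d₁ t ^ n + d₂ t ^ n)))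
        (Set.Ioo 0 1) := (((h1I.add hi₁).add hi₂).const_mul _).const_mul _
    exact this.lintegral_lt_top.ne
  have hBd : ∀ {x t : ℝ}, t ∈ Set.Ioo (0 : ℝ) 1 → |x| ≤ 3 * C ^ 2 * (1 + d₁ t + d₂ t) →
      ENNReal.ofReal (|x| ^ n) ≤ B t := by
    intro x t ht hx
    refine ENNReal.ofReal_le_ofReal ((pow_le_pow_left₀ (abs_nonneg _) hx n).trans ?_)
    rw [mul_pow]
    gcongr
    exact add_three_pow_le (hn₁ t ht) (hn₂ t ht) n
  have hdB : ∀ t ∈ Set.Ioo (0 : ℝ) 1, |d t| ≤ 3 * C ^ 2 * (1 + d₁ t + d₂ t) := by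
    intro t ht
    have a1 := hn₁ t ht
    have a2 := hn₂ t ht
    have b0 : |d t| ≤ d₁ t + d₂ t := by
      simp only [hd]
      split_ifs <;> rw [abs_of_nonneg (by assumption)] <;> linarith
    have c2 : 1 ≤ C ^ 2 := by nlinarith
    have : 1 * (1 + d₁ t + d₂ t) ≤ 3 * C ^ 2 * (1 + d₁ t + d₂ t) :=
      mul_le_mul_of_nonneg_right (by linarith) (by linarith)
    linarith
  have hlim : ∀ {f : ℕ → ℝ → ℝ} {g : ℝ → ℝ}, (∀ j, Measurable (f j)) →
      (∀ j, ∀ t ∈ Set.Ioo (0 : ℝ) 1, |f j t| ≤ 3 * C ^ 2 * (1 + d₁ t + d₂ t)) →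
      (∀ᵐ t ∂(volume.restrict (Set.Ioo (0 : ℝ) 1)),
        ∀ᶠ j : ℕ in atTop, h j t ≠ 0 ∧ f j t = g t) →
      Tendsto (fun j => ∫⁻ t in Set.Ioo (0 : ℝ) 1 ∩ {t | h j t ≠ 0}, ENNReal.ofReal (|f j t| ^ n))
        atTop (𝓝 (∫⁻ t in Set.Ioo (0 : ℝ) 1, ENNReal.ofReal (|g t| ^ n))) := by
    intro f g hf hfb hfg
    have hfm : ∀ j, Measurable fun t => ENNReal.ofReal (|f j t| ^ n) := fun j =>
      ((continuous_abs.measurable.comp (hf j)).pow_const n).ennreal_ofReal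
    simp only [Set.inter_comm (Set.Ioo (0 : ℝ) 1)]
    simp only [← setLIntegral_indicator (hset _)]
    refine tendsto_lintegral_of_dominated_convergence B (fun j => (hfm j).indicator (hset j))
      (fun j => ?_) hBfin ?_
    · refine (ae_restrict_iff' measurableSet_Ioo).2 (Eventually.of_forall fun t ht => ?_)
      exact (Set.indicator_le_self _ _ t).trans (hBd ht (hfb j t ht))
    · filter_upwards [hfg] with t ht
      refine tendsto_const_nhds.congr' ?_
      filter_upwards [ht] with j hj
      rw [Set.indicator_of_mem (show t ∈ {t | h j t ≠ 0} from hj.1), hj.2]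
  have hL := hlim (f := fun _ => d) (g := d) (fun _ => hdm) (fun _ => hdB)
    (hae'.mono fun t ht => ht.mono fun j hj => ⟨hj.1, rfl⟩)
  have hR := hlim (f := fun j t => d t + deriv (h j) t) (g := fun _ => 1)
    (fun j => hdm.add (measurable_deriv _)) hbound hae'
  have hR' := ENNReal.Tendsto.const_mul (a := ENNReal.ofReal Q) hR (Or.inr ENNReal.ofReal_ne_top)
  -- In the limit the sets fill the interval up to a null set and the competitor becomes the
  -- diagonal, of energy `1`.
  have := le_of_tendsto_of_tendsto' hL hR' fun j =>
    hquasi (h j) (htest j).1 (htest j).2.1 (htest j).2.2 (hnn j)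
  simpa using this

/-! ### Energy of the minimum and conclusion -/

theorem intervalIntegrable_reflected_rpow_energy {n : ℕ} (hn : 1 ≤ n) {α : ℝ}
    (hα : 0 < n * α - n + 1) :
    IntervalIntegrable (fun t : ℝ => (α * (1 - t) ^ (α - 1)) ^ n) volume 0 1 := by
  have h : IntervalIntegrable (fun t : ℝ => (α * t ^ (α - 1)) ^ n) volume 0 1 :=
    (intervalIntegrable_iff_integrableOn_Ioc_of_le zero_le_one).2
      (integrableOn_rpow_energy hn hα le_rfl)
  have := h.comp_sub_left 1
  simp only [sub_zero, sub_self] at this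
  exact this.symm

/-- The energy on the whole interval equals the quasiminimizing constant, while the diagonal has
energy `1`. There is thus no slack, and any strict increase of energy is fatal. -/
theorem integral_reflected_rpow_energy {n : ℕ} (hn : 1 ≤ n) {α : ℝ} (hα : 0 < n * α - n + 1) :
    ∫ t in (0 : ℝ)..1, (α * (1 - t) ^ (α - 1)) ^ n = α ^ n / (n * α - n + 1) := by
  rw [intervalIntegral.integral_comp_sub_left (fun t : ℝ => (α * t ^ (α - 1)) ^ n) 1, sub_self,
    sub_zero, integral_rpow_energy hn hα le_rfl zero_le_one, Real.zero_rpow hα.ne', Real.one_rpow,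
    sub_zero, mul_one]

/-- The minimum of the two power profiles has strictly more energy than the second one. -/
theorem lt_lintegral_deriv_min {n : ℕ} (hn : 2 ≤ n) {α₁ α₂ c : ℝ} (h1 : 1 < α₁)
    (h2 : 0 < n * α₂ - n + 1) (h2' : α₂ < 1) (hc : c ∈ Set.Ioo (0 : ℝ) 1)
    (hlt : ∀ t ∈ Set.Ioo 0 c, t ^ α₁ < 1 - (1 - t) ^ α₂) (hceq : c ^ α₁ = 1 - (1 - c) ^ α₂) :
    ENNReal.ofReal (α₂ ^ n / (n * α₂ - n + 1)) <
      ∫⁻ t in Set.Ioo (0 : ℝ) 1, ENNReal.ofReal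
        (|if t < c then α₁ * t ^ (α₁ - 1) else α₂ * (1 - t) ^ (α₂ - 1)| ^ n) := by
  have hn1 : 1 ≤ n := by omega
  have hα₂ := pos_of_exponent_pos hn1 h2
  have hβ₁ : 0 < n * α₁ - n + 1 := by
    have : (0 : ℝ) < n := by positivity
    nlinarith
  set F : ℝ → ℝ := fun t =>
    |if t < c then α₁ * t ^ (α₁ - 1) else α₂ * (1 - t) ^ (α₂ - 1)| ^ n with hF
  have hI2 := intervalIntegrable_reflected_rpow_energy hn1 h2
  have hI2a : IntervalIntegrable (fun t : ℝ => (α₂ * (1 - t) ^ (α₂ - 1)) ^ n) volume 0 c :=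
    hI2.mono_set (by rw [Set.uIcc_of_le hc.1.le, Set.uIcc_of_le zero_le_one]
                     exact Set.Icc_subset_Icc_right hc.2.le)
  have hI2b : IntervalIntegrable (fun t : ℝ => (α₂ * (1 - t) ^ (α₂ - 1)) ^ n) volume c 1 :=
    hI2.mono_set (by rw [Set.uIcc_of_le hc.2.le, Set.uIcc_of_le zero_le_one]
                     exact Set.Icc_subset_Icc_left hc.1.le)
  have hI1 : IntervalIntegrable (fun t : ℝ => (α₁ * t ^ (α₁ - 1)) ^ n) volume 0 c :=
    (intervalIntegrable_iff_integrableOn_Ioc_of_le hc.1.le).2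
      (integrableOn_rpow_energy hn1 hβ₁ le_rfl)
  have eF1 : Set.EqOn (fun t : ℝ => (α₁ * t ^ (α₁ - 1)) ^ n) F (Set.Ioo 0 c) := by
    intro t ht
    have : 0 ≤ α₁ * t ^ (α₁ - 1) := mul_nonneg (by linarith) (Real.rpow_nonneg ht.1.le _)
    simp only [hF, if_pos ht.2, abs_of_nonneg this]
  have eF2 : Set.EqOn (fun t : ℝ => (α₂ * (1 - t) ^ (α₂ - 1)) ^ n) F (Set.Ioo c 1) := by
    intro t ht
    have : 0 ≤ α₂ * (1 - t) ^ (α₂ - 1) :=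
      mul_nonneg hα₂.le (Real.rpow_nonneg (by linarith [ht.2]) _)
    simp only [hF, if_neg ht.1.not_gt, abs_of_nonneg this]
  have hF1 : IntervalIntegrable F volume 0 c := by
    refine hI1.congr_uIoo ?_
    rwa [Set.uIoo_of_le hc.1.le]
  have hF2 : IntervalIntegrable F volume c 1 := by
    refine hI2b.congr_uIoo ?_
    rwa [Set.uIoo_of_le hc.2.le]
  have hFint : IntegrableOn F (Set.Ioo 0 1) :=
    ((intervalIntegrable_iff_integrableOn_Ioc_of_le zero_le_one).1 (hF1.trans hF2)).mono_set
      Set.Ioo_subset_Ioc_self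
  rw [← ofReal_integral_eq_lintegral_ofReal hFint
    (Eventually.of_forall fun t => pow_nonneg (abs_nonneg _) _), ← integral_Ioc_eq_integral_Ioo,
    ← intervalIntegral.integral_of_le zero_le_one,
    ← intervalIntegral.integral_add_adjacent_intervals hF1 hF2,
    ← intervalIntegral.integral_congr_Ioo_of_le hc.1.le eF1,
    ← intervalIntegral.integral_congr_Ioo_of_le hc.2.le eF2,
    ← integral_reflected_rpow_energy hn1 h2,
    ← intervalIntegral.integral_add_adjacent_intervals hI2a hI2b]
  have hlt' := integral_deriv_pow_lt hn h1 hα₂ h2' hc.1 hc.2 hlt hceq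
  have hnn : 0 ≤ ∫ t in (0 : ℝ)..c, (α₂ * (1 - t) ^ (α₂ - 1)) ^ n :=
    intervalIntegral.integral_nonneg hc.1.le fun t ht => pow_nonneg (mul_nonneg hα₂.le
      (Real.rpow_nonneg (by linarith [ht.2, hc.2]) _)) _
  have hnn' : 0 ≤ ∫ t in c..1, (α₂ * (1 - t) ^ (α₂ - 1)) ^ n :=
    intervalIntegral.integral_nonneg hc.2.le fun t ht => pow_nonneg (mul_nonneg hα₂.le
      (Real.rpow_nonneg (by linarith [ht.2]) _)) _
  exact (ENNReal.ofReal_lt_ofReal_iff (by linarith)).2 (by linarith)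

theorem not_isQuasisuperminimizer_min {n : ℕ} (hn : 2 ≤ n) {α₁ α₂ : ℝ} (h1 : 1 < α₁)
    (h2 : 0 < n * α₂ - n + 1) (h2' : α₂ < 1) :
    ¬ IsQuasisuperminimizer (annulus n) n (α₂ ^ n / (n * α₂ - n + 1)) fun x =>
      min ((1 + Real.log ‖x‖) ^ α₁) (1 - (1 - (1 + Real.log ‖x‖)) ^ α₂) := by
  intro hV
  have hn1 : 1 ≤ n := by omega
  have hα₂ := pos_of_exponent_pos hn1 h2
  have hβ₁ : 0 < n * α₁ - n + 1 := by
    have : (0 : ℝ) < n := by positivity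
    nlinarith
  obtain ⟨c, hc, hlt, hceq, hgt⟩ := exists_unique_crossing h1 hα₂ h2'
  set d₁ : ℝ → ℝ := fun t => α₁ * t ^ (α₁ - 1) with hd₁
  set d₂ : ℝ → ℝ := fun t => α₂ * (1 - t) ^ (α₂ - 1) with hd₂
  have P₁ := profile_rpow hn1 hβ₁
  have P₂ := (profile_rpow hn1 h2).reflect
  set V : ℝ → ℝ := fun t => min (t ^ α₁) (1 - (1 - t) ^ α₂) with hVdef
  set d : ℝ → ℝ := fun t => if t < c then d₁ t else d₂ t with hd
  have hdm : Measurable d := Measurable.ite measurableSet_Iio P₁.meas P₂.meas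
  have hdc : ContinuousOn d (Set.Ioo 0 1 \ {c}) := by
    rintro t ⟨ht, htc⟩
    have hn0 : Set.Ioo (0 : ℝ) 1 ∈ 𝓝 t := isOpen_Ioo.mem_nhds ht
    refine ContinuousAt.continuousWithinAt ?_
    rcases lt_or_gt_of_ne (show t ≠ c from htc) with h | h
    · refine (P₁.contDeriv.continuousAt hn0).congr ?_
      filter_upwards [gt_mem_nhds h] with s hs
      simp only [hd, hd₁, if_pos hs]
    · refine (P₂.contDeriv.continuousAt hn0).congr ?_
      filter_upwards [lt_mem_nhds h] with s hs
      simp only [hd, hd₂, if_neg hs.not_gt]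
  have hdd : ∀ t ∈ Set.Ioo (0 : ℝ) 1 \ {c}, HasDerivAt V (d t) t := by
    rintro t ⟨ht, htc⟩
    rcases lt_or_gt_of_ne (show t ≠ c from htc) with h | h
    · simp only [hd, if_pos h]
      refine (P₁.deriv t ht).congr_of_eventuallyEq ?_
      filter_upwards [isOpen_Ioo.mem_nhds (⟨ht.1, h⟩ : t ∈ Set.Ioo 0 c)] with s hs
      exact min_eq_left (hlt s hs).le
    · simp only [hd, if_neg h.not_gt]
      refine (P₂.deriv t ht).congr_of_eventuallyEq ?_
      filter_upwards [isOpen_Ioo.mem_nhds (⟨h, ht.2⟩ : t ∈ Set.Ioo c 1)] with s hs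
      exact min_eq_right (hgt s hs).le
  -- The minimum has energy above the constant, whereas the quasisuperminimizing inequality would
  -- bound it by that constant.
  refine (lt_lintegral_deriv_min hn h1 h2 h2' hc hlt hceq).not_ge ?_
  refine lintegral_deriv_min_le P₁.cont P₂.cont ?_ ?_ P₁.deriv P₂.deriv P₁.meas P₂.meas
    P₁.nonneg P₂.nonneg ?_ ?_ ?_ ?_ ?_ ?_ hlt hgt ?_
    fun h hs hcs hsub hnn => hV.lintegral_profile_le (V := V) (c := c) hn1 hdm hdc hdd hs hcs hsub hnn
  · exact contDiffOn_id.rpow_const_of_ne fun t ht => ht.1.ne'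
  · exact contDiffOn_const.sub ((contDiffOn_const.sub contDiffOn_id).rpow_const_of_ne
      fun t ht => (sub_pos.2 ht.2).ne')
  · exact (integrableOn_rpow_energy hn1 hβ₁ le_rfl).mono_set Set.Ioo_subset_Ioc_self
  · exact ((intervalIntegrable_iff_integrableOn_Ioc_of_le zero_le_one).1
      (intervalIntegrable_reflected_rpow_energy hn1 h2)).mono_set Set.Ioo_subset_Ioc_self
  · exact Real.zero_rpow (by linarith)
  · simp
  · simp
  · simp [Real.zero_rpow hα₂.ne']
  · intro t ht
    simpa using Real.rpow_lt_rpow_of_exponent_gt ht.1 ht.2 h1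

theorem IsQuasiminimizer.isQuasisuperminimizer {n : ℕ} {Ω : Set (EuclideanSpace ℝ (Fin n))}
    {p Q : ℝ} {u : EuclideanSpace ℝ (Fin n) → ℝ} (h : IsQuasiminimizer Ω p Q u) :
    IsQuasisuperminimizer Ω p Q u := by
  obtain ⟨gu, hgu, hq⟩ := h
  exact ⟨gu, hgu, fun φ gφ hφ _ => hq φ gφ hφ⟩

end QuasiMin

theorem theorem1p2 (n : ℕ) (hn : 2 ≤ n) (Q₁ Q₂ : ℝ) (hQ₁ : 1 < Q₁) (hQ₂ : Q₁ ≤ Q₂) :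
    ∃ u₁ u₂ : EuclideanSpace ℝ (Fin n) → ℝ,
      (∃ α₁ α₂ : ℝ, 1 < α₁ ∧ 1 - 1 / (n : ℝ) < α₂ ∧ α₂ < 1 ∧
        Q₁ = α₁ ^ n / (n * α₁ - n + 1) ∧ Q₂ = α₂ ^ n / (n * α₂ - n + 1) ∧
        (∀ x ∈ QuasiMin.annulus n, u₁ x = Real.log ‖Real.exp 1 • x‖ ^ α₁) ∧
        (∀ x ∈ QuasiMin.annulus n, u₂ x = 1 - (-Real.log ‖x‖) ^ α₂)) ∧
      QuasiMin.IsQuasisuperminimizer (QuasiMin.annulus n) n Q₁ u₁ ∧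
      QuasiMin.IsQuasisuperminimizer (QuasiMin.annulus n) n Q₂ u₂ ∧
      ¬ QuasiMin.IsQuasisuperminimizer (QuasiMin.annulus n) n Q₂ (fun x => min (u₁ x) (u₂ x)) ∧
      ¬ QuasiMin.IsQuasiminimizer (QuasiMin.annulus n) n Q₂ (fun x => min (u₁ x) (u₂ x)) := by
  have hn1 : 1 ≤ n := by omega
  have hn0 : (0 : ℝ) < n := by positivity
  obtain ⟨α₁, h1, e1⟩ := QuasiMin.exists_exponent_gt_one hn hQ₁
  obtain ⟨α₂, h2, h2', e2⟩ := QuasiMin.exists_exponent_lt_one hn (hQ₁.trans_le hQ₂)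
  have hβ₁ : 0 < n * α₁ - n + 1 := by nlinarith
  have hβ₂ : 0 < n * α₂ - n + 1 := by
    have := mul_lt_mul_of_pos_left h2 hn0
    have e : (n : ℝ) * (1 - 1 / n) = n - 1 := by field_simp
    linarith
  have hnot := QuasiMin.not_isQuasisuperminimizer_min hn h1 hβ₂ h2'
  rw [← e2] at hnot
  -- Both functions are written in the variable `1 + log |x|`, which equals `log |e x|` on the
  -- annulus.
  refine ⟨fun x => (1 + Real.log ‖x‖) ^ α₁, fun x => 1 - (1 - (1 + Real.log ‖x‖)) ^ α₂,
    ⟨α₁, α₂, h1, h2, h2', e1, e2, fun x hx => ?_, fun x hx => ?_⟩, ?_, ?_, hnot,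
    fun h => hnot h.isQuasisuperminimizer⟩
  · have hx0 := norm_ne_zero_iff.2 (QuasiMin.ne_zero_of_mem_annulus hx)
    rw [norm_smul, Real.norm_of_nonneg (Real.exp_pos 1).le,
      Real.log_mul (Real.exp_pos 1).ne' hx0, Real.log_exp]
  · simp only [sub_add_cancel_left]
  · rw [e1]
    exact (QuasiMin.profile_rpow hn1 hβ₁).isQuasisuperminimizer hn1
  · rw [e2]
    exact (QuasiMin.profile_rpow hn1 hβ₂).reflect.isQuasisuperminimizer hn1
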